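/- Let $N\ge 2$, let $y_1,\dots,y_N\in\mathbb R^3$ be distinct, $Y=\{y_j\}_{j=1}^N$, and let $a=(a_j)_{j=1}^N\in\mathbb C^N$. Put $$\Gamma_{a,Y}(z)=\Big[\big(a_j-\tfrac{iz}{4\pi}\big)\delta_{jj'}-\widetilde G_z(y_j-y_{j'})\Big]_{j,j'=1}^N,\qquad \widetilde G_z(x)=\frac{e^{iz|x|}}{4\pi|x|}\ (x\ne0),\quad \widetilde G_z(0)=0 .$$ The resonances of the point interaction Hamiltonian $H_{a,Y}$ are the zeros of the entire function $\det\Gamma_{a,Y}$, counted with multiplicity. For $\mu\in\mathbb R$ and $R>0$ let $N^{\log}(\mu,R)$ be the number (with multiplicity) of resonances $k$ with $-\mu\ln(|\operatorname{Re}k|+1)\le\operatorname{Im}k$ and $|k|\le R$, and let $$d^{\log}(\mu)=\lim_{R\to\infty}\frac{N^{\log}(\mu,R)}{R},$$ where the upper limit is taken at those $\mu$, if any, at which the limit does not exist. Write $D(\zeta)=(-4\pi)^N\det\Gamma_{a,Y}(i\zeta)=\sum_{j=0}^{\nu}P_{\beta_j}(\zeta)e^{\beta_j\zeta}$ with $\beta_0<\dots<\beta_\nu=0$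 and nonzero polynomials $P_{\beta_j}$, and put $T_{\beta_j}=\beta_j+i\deg P_{\beta_j}\in\mathbb C$. The distribution diagram of $D$ is the polygonal line, convex upward, that joins $T_{\beta_0}$ with $T_{\beta_\nu}$, has all its vertices among the points $T_{\beta_j}$, and has none of these points above it. Let $[T_{b_{n-1}},T_{b_n}]$, $n=1,\dots,M$, $\beta_0=b_0<b_1<\dots<b_M=0$, be its successive maximal segments, and put $$r_n=\deg P_{b_n}-\deg P_{b_{n-1}},\qquad \mu_n=\frac{r_n}{b_n-b_{n-1}} .$$ Then $M\ge 1$, $\mu_n>0$ for every $n$, the limit that defines $d^{\log}(\mu)$ exists for every real $\mu\notin\{\mu_1,\dots,\mu_M\}$, and $d^{\log}$ is a nondecreasing, piecewise constant function on $\mathbb R$ with finitely many jumps. Its jumps are exactly at the points $\mu_1,\dots,\mu_M$ (and it is constant on every interval that contains none of them), and $$d^{\log}(\mu_n+0)-d^{\log}(\mu_n-0)=\frac{b_n-b_{n-1}}{\pi}=\frac{r_n}{\pi\mu_n},\qquad n=1,\dots,M .$$ -/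

import Mathlib

open Filter Topology

noncomputable section

namespace PointInteraction

/-- The integral kernel `G_z (x) = exp (i z |x|) / (4 π |x|)` of `(-Δ - z ^ 2)⁻¹` on `ℝ³`,
set equal to zero at `x = 0`. -/
def green (z : ℂ) (x : EuclideanSpace ℝ (Fin 3)) : ℂ :=
  if x = 0 then 0 else Complex.exp (Complex.I * z * (‖x‖ : ℂ)) / (4 * (Real.pi : ℂ) * (‖x‖ : ℂ))

/-- The matrix `Γ_{a,Y} (z)` of the Krein formula for the resolvent of `H_{a,Y}`. -/
def gammaMatrix {N : ℕ} (a : Fin N → ℂ) (y : Fin N → EuclideanSpace ℝ (Fin 3)) (z : ℂ) :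
    Matrix (Fin N) (Fin N) ℂ :=
  Matrix.of fun j k =>
    (if j = k then a j - Complex.I * z / (4 * (Real.pi : ℂ)) else 0) - green z (y j - y k)

/-- The characteristic determinant `det Γ_{a,Y}`. -/
def charDet {N : ℕ} (a : Fin N → ℂ) (y : Fin N → EuclideanSpace ℝ (Fin 3)) (z : ℂ) : ℂ :=
  (gammaMatrix a y z).det

/-- The set of resonances of `H_{a,Y}`: the zeros of the characteristic determinant. -/
def resonances {N : ℕ} (a : Fin N → ℂ) (y : Fin N → EuclideanSpace ℝ (Fin 3)) : Set ℂ :=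
  {k | charDet a y k = 0}

/-- The multiplicity of a resonance: its multiplicity as a zero of the (entire) characteristic
determinant. -/
def multiplicity {N : ℕ} (a : Fin N → ℂ) (y : Fin N → EuclideanSpace ℝ (Fin 3)) (k : ℂ) : ℕ :=
  analyticOrderNatAt (charDet a y) k

/-- The logarithmic counting function `N^log (μ, R)`: the number of resonances `k`, counted with
multiplicity, such that `-μ ln (|Re k| + 1) ≤ Im k` and `|k| ≤ R`. -/
def logCount {N : ℕ} (a : Fin N → ℂ) (y : Fin N → EuclideanSpace ℝ (Fin 3)) (μ R : ℝ) : ℕ :=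
  ∑ᶠ k ∈ {k : ℂ | k ∈ resonances a y ∧ -μ * Real.log (|k.re| + 1) ≤ k.im ∧ ‖k‖ ≤ R},
    multiplicity a y k

/-- The logarithmic asymptotic density `d^log (μ)`, the limit of `N^log (μ, R) / R` as `R → ∞`.
It is written as an upper limit, which is the limit wherever the limit exists, so that it is
defined for every real `μ`; that the limit exists is a separate assertion. -/
def logDensity {N : ℕ} (a : Fin N → ℂ) (y : Fin N → EuclideanSpace ℝ (Fin 3)) (μ : ℝ) : ℝ :=
  limsup (fun R : ℝ => (logCount a y μ R : ℝ) / R) atTop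

/-- The modified characteristic determinant `D (ζ) = (-4 π) ^ N det Γ_{a,Y} (i ζ)`. -/
def modDet {N : ℕ} (a : Fin N → ℂ) (y : Fin N → EuclideanSpace ℝ (Fin 3)) (ζ : ℂ) : ℂ :=
  (-4 * (Real.pi : ℂ)) ^ N * charDet a y (Complex.I * ζ)

/-- The exponent `α (σ)` of the term of `D` that belongs to the permutation `σ`. -/
def permFreq {N : ℕ} (y : Fin N → EuclideanSpace ℝ (Fin 3)) (σ : Equiv.Perm (Fin N)) : ℝ :=
  -∑ j with σ j ≠ j, ‖y j - y (σ j)‖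

/-- The polynomial factor `p^[σ]` of the term of `D` that belongs to the permutation `σ`. -/
def permPoly {N : ℕ} (a : Fin N → ℂ) (y : Fin N → EuclideanSpace ℝ (Fin 3))
    (σ : Equiv.Perm (Fin N)) : Polynomial ℂ :=
  Polynomial.C (((Equiv.Perm.sign σ : ℤ) : ℂ) * ∏ j with σ j ≠ j, ((‖y j - y (σ j)‖ : ℂ))⁻¹) *
    ∏ j with σ j = j, (-Polynomial.X - Polynomial.C (4 * (Real.pi : ℂ) * a j))

/-- The polynomial `P_b` that multiplies `exp (b ζ)` in the canonical form of `D`. -/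
def freqPoly {N : ℕ} (a : Fin N → ℂ) (y : Fin N → EuclideanSpace ℝ (Fin 3)) (b : ℝ) :
    Polynomial ℂ :=
  ∑ σ : Equiv.Perm (Fin N) with permFreq y σ = b, permPoly a y σ

/-- The frequencies `β_0 < ... < β_ν` of `D`: the exponents that survive cancellation. -/
def frequencies {N : ℕ} (a : Fin N → ℂ) (y : Fin N → EuclideanSpace ℝ (Fin 3)) : Set ℝ :=
  {b | freqPoly a y b ≠ 0}

/-- Leibniz expansion of `D`. -/
theorem modDet_eq_sum_perm {N : ℕ} (a : Fin N → ℂ) (y : Fin N → EuclideanSpace ℝ (Fin 3))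
    (hy : Function.Injective y) (ζ : ℂ) :
    modDet a y ζ =
      ∑ σ : Equiv.Perm (Fin N), Complex.exp (permFreq y σ * ζ) * (permPoly a y σ).eval ζ := by
  have hpi : (Real.pi : ℂ) ≠ 0 := by exact_mod_cast Real.pi_ne_zero
  unfold modDet charDet
  rw [← Matrix.det_transpose, Matrix.det_apply', Finset.mul_sum]
  refine Finset.sum_congr rfl fun σ _ => ?_
  have hN : (-4 * (Real.pi : ℂ)) ^ N = ∏ _j : Fin N, (-4 * (Real.pi : ℂ)) := by simp
  rw [hN, mul_left_comm, ← Finset.prod_mul_distrib,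
    ← Finset.prod_filter_mul_prod_filter_not Finset.univ (fun j => σ j = j)]
  have h1 : ∀ j ∈ Finset.univ.filter (fun j => σ j = j),
      (-4 * (Real.pi : ℂ)) * (gammaMatrix a y (Complex.I * ζ)).transpose (σ j) j =
        -ζ - 4 * (Real.pi : ℂ) * a j := by
    intro j hj
    have hj' : σ j = j := (Finset.mem_filter.mp hj).2
    simp only [gammaMatrix, green, Matrix.transpose_apply, Matrix.of_apply, hj', sub_self, if_true,
      sub_zero]
    field_simp
    linear_combination ζ * Complex.I_sq
  have h2 : ∀ j ∈ Finset.univ.filter (fun j => ¬ σ j = j),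
      (-4 * (Real.pi : ℂ)) * (gammaMatrix a y (Complex.I * ζ)).transpose (σ j) j =
        Complex.exp (-(‖y j - y (σ j)‖ : ℂ) * ζ) * ((‖y j - y (σ j)‖ : ℂ))⁻¹ := by
    intro j hj
    have hj' : ¬ σ j = j := (Finset.mem_filter.mp hj).2
    have hne : y j - y (σ j) ≠ 0 := fun h => hj' (hy (sub_eq_zero.mp h)).symm
    have hnorm : ((‖y j - y (σ j)‖ : ℝ) : ℂ) ≠ 0 := by
      exact_mod_cast norm_ne_zero_iff.mpr hne
    simp only [gammaMatrix, green, Matrix.transpose_apply, Matrix.of_apply, if_neg hne,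
      if_neg (Ne.symm hj'), zero_sub]
    have he : Complex.I * (Complex.I * ζ) * (‖y j - y (σ j)‖ : ℂ) =
        -(‖y j - y (σ j)‖ : ℂ) * ζ := by
      linear_combination (ζ * (‖y j - y (σ j)‖ : ℂ)) * Complex.I_sq
    rw [he]
    field_simp
  rw [Finset.prod_congr rfl h1, Finset.prod_congr rfl h2, Finset.prod_mul_distrib,
    ← Complex.exp_sum]
  have h3 : (∑ j with ¬ σ j = j, -(‖y j - y (σ j)‖ : ℂ) * ζ) = (permFreq y σ : ℂ) * ζ := by
    simp only [permFreq, ne_eq]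
    push_cast
    rw [← Finset.sum_mul, Finset.sum_neg_distrib]
  rw [h3]
  simp only [permPoly, Polynomial.eval_mul, Polynomial.eval_C, Polynomial.eval_prod,
    Polynomial.eval_sub, Polynomial.eval_neg, Polynomial.eval_X, ne_eq]
  ring

/-- The canonical form of `D`: the family `P_b` defined above is the one that belongs to `D`. -/
theorem modDet_eq_canonical {N : ℕ} (a : Fin N → ℂ) (y : Fin N → EuclideanSpace ℝ (Fin 3))
    (hy : Function.Injective y) (ζ : ℂ) :
    modDet a y ζ = ∑ᶠ b : ℝ, (freqPoly a y b).eval ζ * Complex.exp (b * ζ) := by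
  classical
  rw [modDet_eq_sum_perm a y hy, finsum_eq_sum_of_support_subset
    (s := Finset.univ.image (permFreq y))]
  · rw [← Finset.sum_fiberwise_of_maps_to (g := permFreq y)
      (fun σ _ => Finset.mem_image_of_mem _ (Finset.mem_univ σ))]
    refine Finset.sum_congr rfl fun b _ => ?_
    rw [freqPoly, Polynomial.eval_finsetSum, Finset.sum_mul]
    refine Finset.sum_congr (by congr) fun σ hσ => ?_
    rw [(Finset.mem_filter.mp hσ).2, mul_comm]
  · intro b hb
    by_contra hn
    apply hb
    have : freqPoly a y b = 0 := by
      refine Finset.sum_eq_zero fun σ hσ => ?_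
      exact absurd (Finset.mem_image.mpr ⟨σ, Finset.mem_univ σ, (Finset.mem_filter.mp hσ).2⟩)
        (by simpa using hn)
    simp [this]

/-- The slope of the segment joining `T_b` and `T_c`, where `T_b = b + i deg P_b`. -/
def slope {N : ℕ} (a : Fin N → ℂ) (y : Fin N → EuclideanSpace ℝ (Fin 3)) (b c : ℝ) : ℝ :=
  (((freqPoly a y c).natDegree : ℝ) - ((freqPoly a y b).natDegree : ℝ)) / (c - b)

/-- `IsDistributionDiagram a y M v` says that the polygonal line with the successive vertices
`T_{v 0}, ..., T_{v M}` (numbered from left to right) is the distribution diagram of `D`, with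
its `M` maximal segments `[T_{v n}, T_{v (n + 1)}]`. -/
structure IsDistributionDiagram {N : ℕ} (a : Fin N → ℂ) (y : Fin N → EuclideanSpace ℝ (Fin 3))
    (M : ℕ) (v : Fin (M + 1) → ℝ) : Prop where
  /-- The vertices are numbered from left to right. -/
  strictMono : StrictMono v
  /-- The vertices are among the points `T_β`. -/
  mem : ∀ i, v i ∈ frequencies a y
  /-- The line starts at the leftmost of the points `T_β`. -/
  left : ∀ b ∈ frequencies a y, v 0 ≤ b
  /-- The line ends at the rightmost of the points `T_β`. -/
  right : ∀ b ∈ frequencies a y, b ≤ v (Fin.last M)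
  /-- The line is convex upward, and no two consecutive segments are collinear. -/
  concave : StrictAnti fun n : Fin M => slope a y (v n.castSucc) (v n.succ)
  /-- None of the points `T_β` lies above the line. -/
  above : ∀ n : Fin M, ∀ b ∈ frequencies a y, v n.castSucc ≤ b → b ≤ v n.succ →
    ((freqPoly a y b).natDegree : ℝ) ≤ ((freqPoly a y (v n.castSucc)).natDegree : ℝ) +
      slope a y (v n.castSucc) (v n.succ) * (b - v n.castSucc)

/-- The first order structural parameter `μ_n`, the slope of the `n`-th segment. -/
def mu {N : ℕ} (a : Fin N → ℂ) (y : Fin N → EuclideanSpace ℝ (Fin 3)) {M : ℕ}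
    (v : Fin (M + 1) → ℝ) (n : Fin M) : ℝ :=
  slope a y (v n.castSucc) (v n.succ)

/-- The multiplicity `r_n` of `μ_n`: the increment of `deg P_β` along the `n`-th segment. -/
def mult {N : ℕ} (a : Fin N → ℂ) (y : Fin N → EuclideanSpace ℝ (Fin 3)) {M : ℕ}
    (v : Fin (M + 1) → ℝ) (n : Fin M) : ℤ :=
  ((freqPoly a y (v n.succ)).natDegree : ℤ) - ((freqPoly a y (v n.castSucc)).natDegree : ℤ)

end PointInteraction

end

/-! Put k = iζ. Then Im k = Re ζ and |Re k| = |Im ζ|, and resonances become zeros of the exponential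
polynomial D in the region Re ζ ≥ -μ log(|Im ζ| + 1), |ζ| ≤ R. On the curve Re ζ = -μ log|Im ζ| the
term P_b(ζ)e^{bζ} has size about |ζ|^{deg P_b - μb}. If μ is no slope of the distribution diagram,
the functional deg P_b - μb has a unique maximum over the frequencies, attained at a vertex v(μ)
(`exists_vertex_max`), and that term dominates D near the curve (`exists_dominatedBy_zone`). In the
right half-plane the term b = 0 dominates, since every other frequency is negative and has smaller
degree (`exists_dominatedBy_right`).

The argument principle is applied to a rectangle of height T/2 between these two dominated zones.
The vertical sides turn the argument by (0 - v(μ))T/2 up to a bounded error. The horizontal sides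
contribute a bounded amount, because by Rolle the real part of an exponential polynomial on a
horizontal line has boundedly many zeros or vanishes identically (`re_expPoly_eq_zero_of_zeros`).
Summing over dyadic pieces in both half-planes gives N^log(μ,R)/R → -v(μ)/π
(`tendsto_zeroCount_logRegion`).

As μ increases past μ_n, the maximizing vertex moves from the right end b_n of the n-th segment to
its left end b_{n-1}, which gives the jump (b_n - b_{n-1})/π. Every slope is positive because deg
P_0 = N exceeds all other degrees and the slopes decrease. There is at least one segment because the
frequency of a transposition cannot cancel (`exists_frequency_ne_zero`). -/

/-! ### Counting zeros with multiplicity -/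

/-- The number of zeros of `f` in `S`, counted with multiplicity. -/
noncomputable def zeroCount (f : ℂ → ℂ) (S : Set ℂ) : ℕ :=
  ∑ᶠ z ∈ S, analyticOrderNatAt f z

/-- By the identity theorem. It is needed because `analyticOrderNatAt` sends the order ⊤ to 0, which
would make a zero invisible to the count. -/
theorem analyticOrderAt_ne_top_of_ne_zero {f : ℂ → ℂ} (hf : Differentiable ℂ f) (h0 : f ≠ 0)
    (z : ℂ) : analyticOrderAt f z ≠ ⊤ := by
  intro h
  apply h0
  have := (AnalyticOnNhd.analyticOrderAt_eq_top_iff_eq_zero (f := f) z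
    (fun w => hf.analyticAt w)).mp h
  exact this

theorem analyticOrderNatAt_ne_zero_iff {f : ℂ → ℂ} (hf : Differentiable ℂ f) (h0 : f ≠ 0)
    (z : ℂ) : analyticOrderNatAt f z ≠ 0 ↔ f z = 0 := by
  have h1 := analyticOrderAt_ne_top_of_ne_zero hf h0 z
  rw [← Nat.cast_ne_zero (R := ℕ∞), Nat.cast_analyticOrderNatAt h1, analyticOrderAt_ne_zero]
  exact ⟨fun h => h.2, fun h => ⟨hf.analyticAt z, h⟩⟩

theorem finite_zeros_of_isBounded {f : ℂ → ℂ} (hf : Differentiable ℂ f) (h0 : f ≠ 0)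
    {S : Set ℂ} (hS : Bornology.IsBounded S) : (S ∩ {z | f z = 0}).Finite := by
  have hK : IsCompact (closure S) := hS.isCompact_closure
  by_contra hinf
  obtain ⟨x, -, hx⟩ := Set.Infinite.exists_accPt_of_subset_isCompact (hs := hinf) hK
    (Set.inter_subset_left.trans subset_closure)
  have h2 : ∃ᶠ z in 𝓝[≠] x, f z = 0 :=
    (accPt_iff_frequently_nhdsNE.mp hx).mono fun z hz => hz.2
  apply h0
  have := AnalyticOnNhd.eq_of_frequently_eq (f := f) (g := 0) (z₀ := x)
    (fun w _ => hf.analyticAt w) (fun w _ => analyticAt_const) h2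
  exact this

/-- A `finsum` with infinite support is 0 by default, so additivity of `zeroCount` rests on this
finiteness. It is the source of the boundedness hypotheses below. -/
theorem finite_inter_support_order {f : ℂ → ℂ} (hf : Differentiable ℂ f) (h0 : f ≠ 0)
    {S : Set ℂ} (hS : Bornology.IsBounded S) :
    (S ∩ Function.support (analyticOrderNatAt f)).Finite := by
  convert finite_zeros_of_isBounded hf h0 hS using 2
  ext z
  exact analyticOrderNatAt_ne_zero_iff hf h0 z

theorem zeroCount_union {f : ℂ → ℂ} (hf : Differentiable ℂ f) (h0 : f ≠ 0)
    {S T : Set ℂ} (hS : Bornology.IsBounded S) (hT : Bornology.IsBounded T) (h : Disjoint S T) :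
    zeroCount f (S ∪ T) = zeroCount f S + zeroCount f T :=
  finsum_mem_union' h (finite_inter_support_order hf h0 hS) (finite_inter_support_order hf h0 hT)

theorem zeroCount_congr {f : ℂ → ℂ} (hf : Differentiable ℂ f) (h0 : f ≠ 0)
    {S T : Set ℂ} (h : ∀ z, f z = 0 → (z ∈ S ↔ z ∈ T)) :
    zeroCount f S = zeroCount f T := by
  unfold zeroCount
  rw [← finsum_mem_inter_support, ← finsum_mem_inter_support (s := T)]
  have hset : S ∩ Function.support (analyticOrderNatAt f) =
      T ∩ Function.support (analyticOrderNatAt f) := ?_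
  · rw [hset]
  ext z
  simp only [Set.mem_inter_iff, Function.mem_support]
  constructor <;> rintro ⟨a, b⟩ <;>
    have := h z ((analyticOrderNatAt_ne_zero_iff hf h0 z).mp b) <;> tauto

theorem zeroCount_mono {f : ℂ → ℂ} (hf : Differentiable ℂ f) (h0 : f ≠ 0)
    {S T : Set ℂ} (hT : Bornology.IsBounded T) (h : ∀ z ∈ S, f z = 0 → z ∈ T) :
    zeroCount f S ≤ zeroCount f T := by
  rw [zeroCount_congr hf h0 (T := S ∩ T) fun z hz => ⟨fun hs => ⟨hs, h z hs hz⟩, fun hs => hs.1⟩]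
  nth_rw 2 [← Set.inter_union_sdiff T S]
  rw [Set.inter_comm T S,
    zeroCount_union hf h0 (hT.subset Set.inter_subset_right) (hT.subset Set.sdiff_subset)]
  · exact Nat.le_add_right _ _
  · exact Set.disjoint_left.mpr fun z hz hz' => hz'.2 hz.1

theorem zeroCount_union_le {f : ℂ → ℂ} (hf : Differentiable ℂ f) (h0 : f ≠ 0)
    {S T : Set ℂ} (hS : Bornology.IsBounded S) (hT : Bornology.IsBounded T) :
    zeroCount f (S ∪ T) ≤ zeroCount f S + zeroCount f T := by
  rw [← Set.union_sdiff_self, zeroCount_union hf h0 hS (hT.subset Set.sdiff_subset)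
    Set.disjoint_sdiff_right]
  exact Nat.add_le_add_left (zeroCount_mono hf h0 hT fun z hz _ => hz.1) _

theorem zeroCount_eq_zero {f : ℂ → ℂ} (hf : Differentiable ℂ f) (h0 : f ≠ 0)
    {S : Set ℂ} (h : ∀ z ∈ S, f z ≠ 0) : zeroCount f S = 0 := by
  refine finsum_mem_eq_zero_of_forall_eq_zero fun z hz => ?_
  by_contra hn
  exact h z hz ((analyticOrderNatAt_ne_zero_iff hf h0 z).mp hn)

theorem zeroCount_mul {f g : ℂ → ℂ} (hf : Differentiable ℂ f) (hf0 : f ≠ 0)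
    (hg : Differentiable ℂ g) (hg0 : g ≠ 0) {S : Set ℂ} (hS : Bornology.IsBounded S) :
    zeroCount (f * g) S = zeroCount f S + zeroCount g S := by
  unfold zeroCount
  rw [← finsum_mem_add_distrib' (finite_inter_support_order hf hf0 hS)
    (finite_inter_support_order hg hg0 hS)]
  refine finsum_mem_congr rfl fun z _ => ?_
  exact analyticOrderNatAt_mul (hf.analyticAt z) (hg.analyticAt z)
    (analyticOrderAt_ne_top_of_ne_zero hf hf0 z) (analyticOrderAt_ne_top_of_ne_zero hg hg0 z)

theorem zeroCount_sub_const {w : ℂ} {S : Set ℂ} (hw : w ∈ S) :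
    zeroCount (fun z => z - w) S = 1 := by
  have hd : Differentiable ℂ (fun z : ℂ => z - w) := by fun_prop
  have h0 : (fun z : ℂ => z - w) ≠ 0 := fun h => by
    have := congrFun h (w + 1); simp at this
  have h1 : analyticOrderNatAt (fun z : ℂ => z - w) w = 1 := by
    have := AnalyticAt.analyticOrderAt_eq_one_of_zero_deriv_ne_zero (hd.analyticAt w)
      (by simp) (by simp)
    simp [analyticOrderNatAt, this]
  rw [zeroCount_congr hd h0 (T := {w}) fun z hz => ?_]
  · rw [zeroCount, finsum_mem_singleton, h1]
  · rw [sub_eq_zero.mp hz]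
    simp [hw]

/-! ### The argument principle on rectangles -/

/-- The integral of `f` over the boundary of the rectangle `[x₀, x₁] × [t₁, t₂]`. -/
noncomputable def rectIntegral (f : ℂ → ℂ) (x₀ x₁ t₁ t₂ : ℝ) : ℂ :=
  (∫ x : ℝ in x₀..x₁, f (x + t₁ * Complex.I)) - (∫ x : ℝ in x₀..x₁, f (x + t₂ * Complex.I)) +
    Complex.I * (∫ t : ℝ in t₁..t₂, f (x₁ + t * Complex.I)) -
    Complex.I * (∫ t : ℝ in t₁..t₂, f (x₀ + t * Complex.I))

theorem rectIntegral_eq_zero {f : ℂ → ℂ} {x₀ x₁ t₁ t₂ : ℝ} (hx : x₀ ≤ x₁) (ht : t₁ ≤ t₂)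
    (hf : ∀ z ∈ Set.Icc x₀ x₁ ×ℂ Set.Icc t₁ t₂, DifferentiableAt ℂ f z) :
    rectIntegral f x₀ x₁ t₁ t₂ = 0 := by
  have := Complex.integral_boundary_rect_eq_zero_of_differentiableOn f ⟨x₀, t₁⟩ ⟨x₁, t₂⟩ (by
    simp only [Set.uIcc_of_le hx, Set.uIcc_of_le ht]
    exact fun z hz => (hf z hz).differentiableWithinAt)
  simpa [rectIntegral] using this

/-- `z` lies on the boundary of the rectangle `[x₀, x₁] × [t₁, t₂]`. -/
def OnRectBoundary (x₀ x₁ t₁ t₂ : ℝ) (z : ℂ) : Prop :=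
  z ∈ Set.Icc x₀ x₁ ×ℂ Set.Icc t₁ t₂ ∧ (z.re = x₀ ∨ z.re = x₁ ∨ z.im = t₁ ∨ z.im = t₂)

theorem intervalIntegral_eq_sub_of_antideriv_horizontal {F f : ℂ → ℂ} {x₀ x₁ t : ℝ} (hx : x₀ ≤ x₁)
    (hF : ∀ x ∈ Set.Icc x₀ x₁, HasDerivAt F (f (x + t * Complex.I)) (x + t * Complex.I))
    (hf : ContinuousOn (fun x : ℝ => f (x + t * Complex.I)) (Set.Icc x₀ x₁)) :
    ∫ x in x₀..x₁, f (x + t * Complex.I) = F (x₁ + t * Complex.I) - F (x₀ + t * Complex.I) := by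
  rw [← Set.uIcc_of_le hx] at hF hf
  refine intervalIntegral.integral_eq_sub_of_hasDerivAt (f := fun x : ℝ => F (x + t * Complex.I))
    (fun x hx' => ?_) hf.intervalIntegrable
  have h1 : HasDerivAt (fun x : ℝ => (x : ℂ) + t * Complex.I) 1 x :=
    (Complex.ofRealCLM.hasDerivAt (x := x)).add_const _
  have h2 := (hF x hx').comp x h1
  rw [mul_one] at h2
  exact h2

theorem intervalIntegral_eq_sub_of_antideriv_vertical {F f : ℂ → ℂ} {x t₁ t₂ : ℝ} (ht : t₁ ≤ t₂)
    (hF : ∀ t ∈ Set.Icc t₁ t₂, HasDerivAt F (f (x + t * Complex.I)) (x + t * Complex.I))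
    (hf : ContinuousOn (fun t : ℝ => f (x + t * Complex.I)) (Set.Icc t₁ t₂)) :
    Complex.I * ∫ t in t₁..t₂, f (x + t * Complex.I) =
      F (x + t₂ * Complex.I) - F (x + t₁ * Complex.I) := by
  rw [← Set.uIcc_of_le ht] at hF hf
  rw [← intervalIntegral.integral_const_mul]
  refine intervalIntegral.integral_eq_sub_of_hasDerivAt (f := fun t : ℝ => F (x + t * Complex.I))
    (fun t ht' => ?_) (continuousOn_const.mul hf).intervalIntegrable
  have h1 : HasDerivAt (fun t : ℝ => (x : ℂ) + t * Complex.I) Complex.I t := by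
    simpa using ((Complex.ofRealCLM.hasDerivAt (x := t)).mul_const Complex.I).const_add (x : ℂ)
  have h2 := (hF t ht').comp t h1
  rw [mul_comm] at h2
  exact h2

/-- The principal branch of log(z - w) is a primitive on three sides. The left side crosses its cut,
and there log(w - z) serves instead. The two branches differ by πi at the lower left corner and by
-πi at the upper left one, and these add up to 2πi. -/
theorem rectIntegral_inv_sub {x₀ x₁ t₁ t₂ : ℝ} {w : ℂ} (hx₀ : x₀ < w.re) (hx₁ : w.re < x₁)
    (ht₁ : t₁ < w.im) (ht₂ : w.im < t₂) :
    rectIntegral (fun z => (z - w)⁻¹) x₀ x₁ t₁ t₂ = 2 * Real.pi * Complex.I := by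
  have hx : x₀ ≤ x₁ := (hx₀.trans hx₁).le
  have ht : t₁ ≤ t₂ := (ht₁.trans ht₂).le
  have key : ∀ z : ℂ, z - w ∈ Complex.slitPlane →
      HasDerivAt (fun z => Complex.log (z - w)) (z - w)⁻¹ z := fun z hz => by
    simpa using ((hasDerivAt_id z).sub_const w).clog hz
  have key' : ∀ z : ℂ, w - z ∈ Complex.slitPlane →
      HasDerivAt (fun z => Complex.log (w - z)) (z - w)⁻¹ z := fun z hz => by
    have := ((hasDerivAt_id z).const_sub w).clog hz
    simp only [id] at this
    convert this using 1
    rw [← neg_sub z w, neg_div_neg_eq, one_div]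
  have hcont : ∀ g : ℝ → ℂ, Continuous g → ∀ s : Set ℝ, (∀ x ∈ s, g x ≠ w) →
      ContinuousOn (fun x => (g x - w)⁻¹) s := fun g hg s hs =>
    (hg.sub continuous_const).continuousOn.inv₀ fun x hxs => sub_ne_zero.mpr (hs x hxs)
  have e1 := intervalIntegral_eq_sub_of_antideriv_horizontal (f := fun z => (z - w)⁻¹) (t := t₁) hx
    (fun x _ => key _ (Complex.mem_slitPlane_iff.mpr (Or.inr (by
      simp [sub_eq_zero, ht₁.ne]))))
    (hcont (fun x : ℝ => x + t₁ * Complex.I) (by fun_prop) _ fun x _ h => ht₁.ne (by simp [← h]))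
  have e2 := intervalIntegral_eq_sub_of_antideriv_horizontal (f := fun z => (z - w)⁻¹) (t := t₂) hx
    (fun x _ => key _ (Complex.mem_slitPlane_iff.mpr (Or.inr (by
      simp [sub_eq_zero, ht₂.ne']))))
    (hcont (fun x : ℝ => x + t₂ * Complex.I) (by fun_prop) _ fun x _ h => ht₂.ne' (by simp [← h]))
  have e3 := intervalIntegral_eq_sub_of_antideriv_vertical (f := fun z => (z - w)⁻¹) (x := x₁) ht
    (fun x _ => key _ (Complex.mem_slitPlane_iff.mpr (Or.inl (by
      simp [hx₁]))))
    (hcont (fun t : ℝ => x₁ + t * Complex.I) (by fun_prop) _ fun x _ h => hx₁.ne' (by simp [← h]))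
  have e4 := intervalIntegral_eq_sub_of_antideriv_vertical (f := fun z => (z - w)⁻¹) (x := x₀) ht
    (fun x _ => key' _ (Complex.mem_slitPlane_iff.mpr (Or.inl (by
      simp [hx₀]))))
    (hcont (fun t : ℝ => x₀ + t * Complex.I) (by fun_prop) _ fun x _ h => hx₀.ne (by simp [← h]))
  unfold rectIntegral
  rw [e1, e2, e3, e4]
  have l1 : Complex.log (w - (x₀ + t₁ * Complex.I)) =
      Complex.log (x₀ + t₁ * Complex.I - w) + Real.pi * Complex.I := by
    rw [← neg_sub, Complex.log, Complex.log, norm_neg,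
      Complex.arg_neg_eq_arg_add_pi_of_im_neg (by simp [ht₁])]
    push_cast; ring
  have l2 : Complex.log (w - (x₀ + t₂ * Complex.I)) =
      Complex.log (x₀ + t₂ * Complex.I - w) - Real.pi * Complex.I := by
    rw [← neg_sub, Complex.log, Complex.log, norm_neg,
      Complex.arg_neg_eq_arg_sub_pi_of_im_pos (by simp [ht₂])]
    push_cast; ring
  rw [l1, l2]
  ring

theorem continuousOn_logDeriv {f : ℂ → ℂ} (hf : Differentiable ℂ f) {g : ℝ → ℂ} (hg : Continuous g)
    {s : Set ℝ} (hs : ∀ x ∈ s, f (g x) ≠ 0) : ContinuousOn (fun x => logDeriv f (g x)) s := by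
  simp only [logDeriv_apply]
  have hd : Continuous (deriv f) := (hf.contDiff (n := 1)).continuous_deriv le_rfl
  exact (hd.comp hg).continuousOn.div (hf.continuous.comp hg).continuousOn hs

theorem rectIntegral_congr_add {f g h : ℂ → ℂ} {x₀ x₁ t₁ t₂ : ℝ} (hx : x₀ ≤ x₁) (ht : t₁ ≤ t₂)
    (hfg : ∀ z, OnRectBoundary x₀ x₁ t₁ t₂ z → f z = g z + h z)
    (hg : ContinuousOn g {z | OnRectBoundary x₀ x₁ t₁ t₂ z})
    (hh : ContinuousOn h {z | OnRectBoundary x₀ x₁ t₁ t₂ z}) :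
    rectIntegral f x₀ x₁ t₁ t₂ = rectIntegral g x₀ x₁ t₁ t₂ + rectIntegral h x₀ x₁ t₁ t₂ := by
  have key : ∀ (a b : ℝ) (hab : a ≤ b) (p : ℝ → ℂ) (_ : Continuous p)
      (_ : ∀ x ∈ Set.Icc a b, OnRectBoundary x₀ x₁ t₁ t₂ (p x)),
      ∫ x in a..b, f (p x) = (∫ x in a..b, g (p x)) + ∫ x in a..b, h (p x) := by
    intro a b hab p hp hpb
    rw [← Set.uIcc_of_le hab] at hpb
    rw [← intervalIntegral.integral_add]
    · exact intervalIntegral.integral_congr fun x hx' => hfg _ (hpb x hx')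
    · exact (hg.comp hp.continuousOn hpb).intervalIntegrable
    · exact (hh.comp hp.continuousOn hpb).intervalIntegrable
  unfold rectIntegral
  rw [key x₀ x₁ hx (fun x => x + t₁ * Complex.I) (by fun_prop)
      (fun x hx' => ⟨by simp [Complex.mem_reProdIm, hx'.1, hx'.2, ht], by simp⟩),
    key x₀ x₁ hx (fun x => x + t₂ * Complex.I) (by fun_prop)
      (fun x hx' => ⟨by simp [Complex.mem_reProdIm, hx'.1, hx'.2, ht], by simp⟩),
    key t₁ t₂ ht (fun t => x₁ + t * Complex.I) (by fun_prop)
      (fun x hx' => ⟨by simp [Complex.mem_reProdIm, hx'.1, hx'.2, hx], by simp⟩),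
    key t₁ t₂ ht (fun t => x₀ + t * Complex.I) (by fun_prop)
      (fun x hx' => ⟨by simp [Complex.mem_reProdIm, hx'.1, hx'.2, hx], by simp⟩)]
  ring

/-- The argument principle for rectangles. -/
theorem rectIntegral_logDeriv {f : ℂ → ℂ} (hf : Differentiable ℂ f)
    {x₀ x₁ t₁ t₂ : ℝ} (hx : x₀ < x₁) (ht : t₁ < t₂)
    (hb : ∀ z, OnRectBoundary x₀ x₁ t₁ t₂ z → f z ≠ 0) :
    rectIntegral (logDeriv f) x₀ x₁ t₁ t₂ =
      2 * Real.pi * Complex.I * zeroCount f (Set.Icc x₀ x₁ ×ℂ Set.Icc t₁ t₂) := by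
  have hbdd : Bornology.IsBounded (Set.Icc x₀ x₁ ×ℂ Set.Icc t₁ t₂) :=
    (isCompact_Icc.reProdIm isCompact_Icc).isBounded
  have hcorner : OnRectBoundary x₀ x₁ t₁ t₂ (x₀ + t₁ * Complex.I) :=
    ⟨by simp [Complex.mem_reProdIm, hx.le, ht.le], by simp⟩
  -- Induction on the number of zeros: dividing out one zero w leaves an entire g with one zero
  -- fewer, and the logarithmic derivative splits off (z - w)⁻¹.
  induction hn : zeroCount f (Set.Icc x₀ x₁ ×ℂ Set.Icc t₁ t₂) generalizing f with
  | zero =>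
    have h0 : f ≠ 0 := fun h => hb _ hcorner (by simp [h])
    rw [rectIntegral_eq_zero hx.le ht.le, Nat.cast_zero, mul_zero]
    intro z hz
    have hz0 : f z ≠ 0 := by
      intro h
      have h2 : 1 ≤ zeroCount f {z} := by
        rw [zeroCount, finsum_mem_singleton]
        exact Nat.one_le_iff_ne_zero.mpr ((analyticOrderNatAt_ne_zero_iff hf h0 z).mpr h)
      have h3 := zeroCount_mono hf h0 (S := {z}) hbdd (fun w hw _ => by
        rw [Set.mem_singleton_iff.mp hw]; exact hz)
      omega
    have hd : DifferentiableAt ℂ (deriv f) z :=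
      ((hf.contDiff (n := 2)).differentiable_deriv_two) z
    exact hd.div (hf z) hz0
  | succ n ih =>
    have h0 : f ≠ 0 := fun h => hb _ hcorner (by simp [h])
    obtain ⟨w, hw, hfw⟩ : ∃ w ∈ Set.Icc x₀ x₁ ×ℂ Set.Icc t₁ t₂, f w = 0 := by
      by_contra! hcon
      rw [zeroCount_eq_zero hf h0 hcon] at hn
      omega
    have hwb : ¬ OnRectBoundary x₀ x₁ t₁ t₂ w := fun h => hb w h hfw
    have hwi : x₀ < w.re ∧ w.re < x₁ ∧ t₁ < w.im ∧ w.im < t₂ := by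
      have hw' := hw
      simp only [Complex.mem_reProdIm, Set.mem_Icc] at hw'
      obtain ⟨⟨a, b⟩, c, d⟩ := hw'
      refine ⟨lt_of_le_of_ne a fun h => hwb ⟨hw, ?_⟩, lt_of_le_of_ne b fun h => hwb ⟨hw, ?_⟩,
        lt_of_le_of_ne c fun h => hwb ⟨hw, ?_⟩, lt_of_le_of_ne d fun h => hwb ⟨hw, ?_⟩⟩ <;> simp [h]
    -- Since f w = 0, `dslope f w` is the quotient f/(z - w), extended holomorphically over w.
    set g := dslope f w with hgdef
    have hg : Differentiable ℂ g := by
      rw [← differentiableOn_univ] at hf ⊢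
      exact (Complex.differentiableOn_dslope Filter.univ_mem).mpr hf
    have hs : Differentiable ℂ (fun z : ℂ => z - w) := by fun_prop
    have hfg : f = (fun z => z - w) * g := by
      ext z
      have := sub_smul_dslope f w z
      simp only [hfw, sub_zero, smul_eq_mul] at this
      simp [hgdef, this]
    have hs0 : (fun z : ℂ => z - w) ≠ 0 := fun h => h0 (by rw [hfg, h, zero_mul])
    have hg0 : g ≠ 0 := fun h => h0 (by rw [hfg, h, mul_zero])
    have hsb : ∀ z, OnRectBoundary x₀ x₁ t₁ t₂ z → z - w ≠ 0 := fun z hz h => by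
      rw [sub_eq_zero] at h
      exact hwb (h ▸ hz)
    have hgb : ∀ z, OnRectBoundary x₀ x₁ t₁ t₂ z → g z ≠ 0 := fun z hz h => by
      apply hb z hz
      rw [hfg]
      simp [h]
    have hcount := zeroCount_mul hs hs0 hg hg0 hbdd
    rw [← hfg, zeroCount_sub_const hw, hn] at hcount
    have hgi := ih hg hgb (by omega)
    rw [rectIntegral_congr_add (g := fun z => (z - w)⁻¹) (h := logDeriv g) hx.le ht.le,
      rectIntegral_inv_sub hwi.1 hwi.2.1 hwi.2.2.1 hwi.2.2.2, hgi]
    · push_cast; ring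
    · intro z hz
      rw [hfg, Pi.mul_def, logDeriv_mul z (hsb z hz) (hgb z hz) (hs z) (hg z)]
      congr 1
      simp [logDeriv_apply]
    · exact fun z hz => ((hs z).continuousAt.inv₀ (hsb z hz)).continuousWithinAt
    · intro z hz
      have hd : Continuous (deriv g) := (hg.contDiff (n := 1)).continuous_deriv le_rfl
      exact (hd.continuousAt.div (hg z).continuousAt (hgb z hz)).continuousWithinAt

/-! ### Exponential polynomials on horizontal lines -/

/-- The exponential polynomial `∑ P_b (ζ) exp (b ζ)` with frequencies in `F`. -/
noncomputable def expPoly (F : Finset ℝ) (P : ℝ → Polynomial ℂ) (ζ : ℂ) : ℂ :=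
  ∑ b ∈ F, (P b).eval ζ * Complex.exp (b * ζ)

theorem hasDerivAt_expPoly (F : Finset ℝ) (P : ℝ → Polynomial ℂ) (ζ : ℂ) :
    HasDerivAt (expPoly F P)
      (expPoly F (fun b => (P b).derivative + Polynomial.C (b : ℂ) * P b) ζ) ζ := by
  unfold expPoly
  refine HasDerivAt.fun_sum fun b _ => ?_
  have h1 := (P b).hasDerivAt ζ
  have h2 : HasDerivAt (fun ζ : ℂ => Complex.exp (b * ζ)) (Complex.exp (b * ζ) * b) ζ := by
    simpa using ((hasDerivAt_id ζ).const_mul (b : ℂ)).cexp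
  refine (h1.mul h2).congr_deriv ?_
  simp only [Polynomial.eval_add, Polynomial.eval_mul, Polynomial.eval_C]
  ring

theorem differentiable_expPoly (F : Finset ℝ) (P : ℝ → Polynomial ℂ) :
    Differentiable ℂ (expPoly F P) := fun ζ => (hasDerivAt_expPoly F P ζ).differentiableAt

theorem expPoly_const_mul (F : Finset ℝ) (P : ℝ → Polynomial ℂ) (c ζ : ℂ) :
    expPoly F (fun b => Polynomial.C c * P b) ζ = c * expPoly F P ζ := by
  simp [expPoly, Finset.mul_sum, mul_assoc]

/-- Rolle's theorem for several zeros. -/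
theorem exists_strictMono_deriv_zeros {n : ℕ} {h h' : ℝ → ℝ} (hd : ∀ x, HasDerivAt h (h' x) x)
    {z : Fin (n + 1) → ℝ} (hz : StrictMono z) (h0 : ∀ i, h (z i) = 0) :
    ∃ z' : Fin n → ℝ, StrictMono z' ∧ ∀ i, h' (z' i) = 0 := by
  have key : ∀ i : Fin n, ∃ c ∈ Set.Ioo (z i.castSucc) (z i.succ), h' c = 0 := fun i =>
    exists_hasDerivAt_eq_zero (hz i.castSucc_lt_succ)
      (fun x _ => (hd x).continuousAt.continuousWithinAt) (by rw [h0, h0]) fun x _ => hd x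
  choose z' hz' hz0 using key
  refine ⟨z', fun i j hij => ?_, hz0⟩
  have : z i.succ ≤ z j.castSucc := hz.monotone (Fin.succ_le_castSucc_iff.mpr hij)
  linarith [(hz' i).2, (hz' j).1]

theorem degree_derivative_lt_of_lt_succ {p : Polynomial ℂ} {n : ℕ} (h : p.degree < (n + 1 : ℕ)) :
    p.derivative.degree < n := by
  rcases eq_or_ne p 0 with rfl | hp
  · simp
  · have h1 := Polynomial.degree_derivative_lt hp
    have h2 : p.degree ≤ n := by
      rw [Polynomial.degree_eq_natDegree hp] at h ⊢
      norm_cast at h ⊢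
      omega
    exact h1.trans_le h2

/-- An exponential polynomial has few zeros of its real part on a horizontal line. -/
theorem re_expPoly_eq_zero_of_zeros (F : Finset ℝ) (t : ℝ) :
    ∀ (n : ℕ) (m : ℝ → ℕ) (P : ℝ → Polynomial ℂ), ∑ b ∈ F, m b = n →
      (∀ b ∈ F, (P b).degree < m b) → ∀ z : Fin n → ℝ, StrictMono z →
      (∀ i, (expPoly F P (z i + t * Complex.I)).re = 0) →
      ∀ x : ℝ, (expPoly F P (x + t * Complex.I)).re = 0 := by
  intro n
  induction n with
  | zero =>
    intro m P hm hP z _ _ x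
    rw [Finset.sum_eq_zero_iff] at hm
    rw [expPoly, Finset.sum_eq_zero, Complex.zero_re]
    intro b hb
    have := hP b hb
    rw [hm b hb, Polynomial.degree_lt_iff_coeff_zero] at this
    rw [show P b = 0 from Polynomial.ext fun i => by simpa using this i (Nat.zero_le i)]
    simp
  | succ n ih =>
    intro m P hm hP z hz h0 x
    obtain ⟨d, hd, hmd⟩ : ∃ d ∈ F, 0 < m d := by
      by_contra! hcon
      rw [Finset.sum_eq_zero fun b hb => Nat.le_zero.mp (hcon b hb)] at hm
      omega
    have hline : ∀ x : ℝ, HasDerivAt (fun x : ℝ => (x : ℂ) + t * Complex.I) 1 x := fun x =>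
      (Complex.ofRealCLM.hasDerivAt (x := x)).add_const _
    -- The real factor e^{-dx} moves the frequency d to 0, so that differentiation lowers the degree
    -- bound of P_d by one and leaves the other bounds intact. Rolle loses one zero in exchange, so
    -- the number of zeros and the sum of the bounds decrease together.
    set h : ℝ → ℝ := fun x => Real.exp (-d * x) * (expPoly F P (x + t * Complex.I)).re with hh
    set Q : ℝ → Polynomial ℂ := fun b => (P b).derivative + Polynomial.C ((b : ℂ) - d) * P b
    have hQ : ∀ ζ, expPoly F Q ζ =
        expPoly F (fun b => (P b).derivative + Polynomial.C (b : ℂ) * P b) ζ - d * expPoly F P ζ := by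
      intro ζ
      simp only [expPoly, Q, Finset.mul_sum, ← Finset.sum_sub_distrib]
      refine Finset.sum_congr rfl fun b _ => ?_
      simp
      ring
    have hder : ∀ x, HasDerivAt h
        (Real.exp (-d * x) * (expPoly F Q (x + t * Complex.I)).re) x := by
      intro x
      have h1 : HasDerivAt (fun x : ℝ => expPoly F P (x + t * Complex.I)) _ x :=
        (hasDerivAt_expPoly F P _).comp x (hline x)
      have h2 := Complex.reCLM.hasFDerivAt.comp_hasDerivAt x h1
      have h3 : HasDerivAt (fun x : ℝ => Real.exp (-d * x)) (Real.exp (-d * x) * (-d)) x := by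
        simpa using ((hasDerivAt_id x).const_mul (-d)).exp
      refine (h3.mul h2).congr_deriv ?_
      rw [hQ]
      simp
      ring
    obtain ⟨z', hz', hz0'⟩ := exists_strictMono_deriv_zeros hder hz fun i => by
      simp only [hh, h0, mul_zero]
    have hzero := ih (fun b => if b = d then m b - 1 else m b) Q ?_ ?_ z' hz' fun i => by
      simpa [Real.exp_ne_zero] using hz0' i
    -- By induction the derivative of h vanishes identically, so h is constant, and it is 0 at z 0.
    · have hconst : ∀ x y, h x = h y := is_const_of_deriv_eq_zero
        (fun x => (hder x).differentiableAt) fun x => by rw [(hder x).deriv, hzero, mul_zero]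
      have := hconst x (z 0)
      simpa [hh, h0, Real.exp_ne_zero] using this
    · have h1 := Finset.add_sum_erase F m hd
      have h2 : ∑ b ∈ F.erase d, (if b = d then m b - 1 else m b) = ∑ b ∈ F.erase d, m b :=
        Finset.sum_congr rfl fun b hb => if_neg (Finset.ne_of_mem_erase hb)
      rw [← Finset.add_sum_erase F _ hd, if_pos rfl, h2]
      omega
    · intro b hb
      by_cases hbd : b = d
      · subst hbd
        simp only [Q, sub_self, Polynomial.C_0, zero_mul, add_zero, if_true]
        refine degree_derivative_lt_of_lt_succ ?_
        rw [Nat.sub_add_cancel hmd]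
        exact hP b hb
      · simp only [Q, if_neg hbd]
        refine (Polynomial.degree_add_le _ _).trans_lt (max_lt ?_ ?_)
        · exact (Polynomial.degree_derivative_le).trans_lt (hP b hb)
        · rw [← Polynomial.smul_eq_C_mul]
          exact (Polynomial.degree_smul_le _ _).trans_lt (hP b hb)

/-- The product of f with the exponential of minus the integral has derivative zero. The integral is
thus a continuous logarithm of f along the segment, and its imaginary part is the argument. -/
theorem exp_integral_logDeriv {f : ℂ → ℂ} (hf : Differentiable ℂ f) {x₀ x₁ t : ℝ}
    (h0 : ∀ x ∈ Set.Icc x₀ x₁, f (x + t * Complex.I) ≠ 0) :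
    ∀ x ∈ Set.Icc x₀ x₁, f (x + t * Complex.I) = f (x₀ + t * Complex.I) *
      Complex.exp (∫ u in x₀..x, logDeriv f (u + t * Complex.I)) := by
  have hcont := continuousOn_logDeriv hf (g := fun x : ℝ => x + t * Complex.I) (by fun_prop) h0
  set J : ℝ → ℂ := fun x => ∫ u in x₀..x, logDeriv f (u + t * Complex.I) with hJ
  have hJ' : ∀ x ∈ Set.Icc x₀ x₁, HasDerivWithinAt J (logDeriv f (x + t * Complex.I))
      (Set.Icc x₀ x₁) x := by
    intro x hx'
    have : Fact (x ∈ Set.Icc x₀ x₁) := ⟨hx'⟩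
    refine intervalIntegral.integral_hasDerivWithinAt_right (s := Set.Icc x₀ x₁)
      (t := Set.Icc x₀ x₁) ?_ ?_ (hcont x hx')
    · refine ContinuousOn.intervalIntegrable ?_
      rw [Set.uIcc_of_le hx'.1]
      exact hcont.mono (Set.Icc_subset_Icc_right hx'.2)
    · exact hcont.stronglyMeasurableAtFilter_nhdsWithin measurableSet_Icc x
  intro x hx'
  set φ : ℝ → ℂ := fun x => f (x + t * Complex.I) * Complex.exp (-J x)
  have hφ : ∀ x ∈ Set.Icc x₀ x₁, HasDerivWithinAt φ 0 (Set.Icc x₀ x₁) x := by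
    intro x hx'
    have h1 : HasDerivAt (fun x : ℝ => f (x + t * Complex.I)) _ x :=
      (hf _).hasDerivAt.comp x ((Complex.ofRealCLM.hasDerivAt (x := x)).add_const _)
    have h2 := (hJ' x hx').neg.cexp
    refine (h1.hasDerivWithinAt.mul h2).congr_deriv ?_
    have := h0 x hx'
    simp only [logDeriv_apply, Pi.neg_apply, Complex.ofRealCLM_apply, Complex.ofReal_one]
    field_simp
    ring
  have hconst : φ x = φ x₀ := constant_of_has_deriv_right_zero
    (fun y hy => (hφ y hy).continuousWithinAt)
    (fun y hy => (hφ y ⟨hy.1, hy.2.le⟩).mono_of_mem_nhdsWithin (Icc_mem_nhdsGE_of_mem hy)) x hx'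
  have hJ0 : J x₀ = 0 := by simp [hJ]
  simp only [φ, hJ0, neg_zero, Complex.exp_zero, mul_one] at hconst
  rw [← hconst, mul_assoc, ← Complex.exp_add, neg_add_cancel, Complex.exp_zero, mul_one]

/-- The variation of the argument of an exponential polynomial along a horizontal segment is
bounded by a constant that depends only on the degrees of its coefficients. -/
theorem abs_im_integral_logDeriv_le {F : Finset ℝ} {P : ℝ → Polynomial ℂ} {m : ℝ → ℕ}
    (hP : ∀ b ∈ F, (P b).degree < m b) {x₀ x₁ t : ℝ} (hx : x₀ ≤ x₁)
    (h0 : ∀ x ∈ Set.Icc x₀ x₁, expPoly F P (x + t * Complex.I) ≠ 0) :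
    |(∫ x in x₀..x₁, logDeriv (expPoly F P) (x + t * Complex.I)).im| ≤
      Real.pi * (∑ b ∈ F, m b + 1 : ℕ) := by
  set f := expPoly F P with hfdef
  have hf : Differentiable ℂ f := differentiable_expPoly F P
  set n := ∑ b ∈ F, m b with hn
  have hcont := continuousOn_logDeriv hf (g := fun x : ℝ => x + t * Complex.I) (by fun_prop) h0
  set J : ℝ → ℂ := fun x => ∫ u in x₀..x, logDeriv f (u + t * Complex.I) with hJ
  have hJc : ContinuousOn J (Set.Icc x₀ x₁) := by
    rw [← Set.uIcc_of_le hx] at hcont ⊢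
    exact intervalIntegral.continuousOn_primitive_interval' hcont.intervalIntegrable
      Set.left_mem_uIcc
  have hexp := exp_integral_logDeriv hf h0
  by_contra! hcon
  obtain ⟨s, hs1, hs⟩ : ∃ s : ℝ, (s = 1 ∨ s = -1) ∧ Real.pi * (n + 1 : ℕ) < s * (J x₁).im := by
    rcases abs_cases (J x₁).im with h | h
    · exact ⟨1, Or.inl rfl, by rw [one_mul, ← h.1]; exact hcon⟩
    · exact ⟨-1, Or.inr rfl, by rw [neg_one_mul, ← h.1]; exact hcon⟩
  have hψ : ContinuousOn (fun x => s * (J x).im) (Set.Icc x₀ x₁) :=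
    continuousOn_const.mul (Complex.continuous_im.comp_continuousOn hJc)
  -- If the argument turned by more than π(n + 1), it would pass through 0, π, ..., (n - 1)π, which
  -- yields n zeros of a real part and forces it to vanish identically. It would also pass through
  -- π/2, where that real part is nonzero.
  have hivt : ∀ v : ℝ, 0 ≤ v → v ≤ Real.pi * (n + 1 : ℕ) →
      ∃ x ∈ Set.Icc x₀ x₁, s * (J x).im = v := fun v hv0 hv1 =>
    intermediate_value_Icc hx hψ ⟨by simpa [hJ] using hv0, (hv1.trans_lt hs).le⟩
  have hx₀ := h0 x₀ ⟨le_rfl, hx⟩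
  -- This factor normalizes f to i at the left end, so that Re (c f) is -e^{Re J} sin(Im J).
  set c : ℂ := Complex.I / f (x₀ + t * Complex.I) with hc
  have hre : ∀ x ∈ Set.Icc x₀ x₁,
      (expPoly F (fun b => Polynomial.C c * P b) (x + t * Complex.I)).re =
        -(Real.exp (J x).re * Real.sin (J x).im) := by
    intro x hx'
    rw [expPoly_const_mul, ← hfdef, hexp x hx', hc, div_mul_eq_mul_div, mul_left_comm,
      mul_div_cancel_left₀ _ hx₀, Complex.I_mul_re, Complex.exp_im]
  have hsin : ∀ x (v : ℝ), s * (J x).im = v → Real.sin (J x).im = s * Real.sin v := by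
    rintro x v rfl
    rcases hs1 with rfl | rfl <;> simp
  have hpts : ∀ k : Fin n, ∃ x ∈ Set.Icc x₀ x₁, s * (J x).im = k * Real.pi := fun k =>
    hivt _ (by positivity) (by
      rw [mul_comm]
      have : (k : ℝ) ≤ ((n + 1 : ℕ) : ℝ) := by exact_mod_cast (k.2.trans (Nat.lt_succ_self n)).le
      gcongr)
  choose p hp hpk using hpts
  have hpinj : Function.Injective p := fun i j hij => by
    have h1 := hpk i
    rw [hij, hpk j] at h1
    have h2 := mul_right_cancel₀ Real.pi_ne_zero h1
    exact Fin.ext (by exact_mod_cast h2.symm)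
  have hcard : (Finset.univ.image p).card = n := by
    rw [Finset.card_image_of_injective _ hpinj, Finset.card_univ, Fintype.card_fin]
  have hall := re_expPoly_eq_zero_of_zeros F t n m (fun b => Polynomial.C c * P b) hn.symm
    (fun b hb => by
      rw [← Polynomial.smul_eq_C_mul]
      exact (Polynomial.degree_smul_le _ _).trans_lt (hP b hb))
    ((Finset.univ.image p).orderEmbOfFin hcard) (OrderEmbedding.strictMono _) (fun i => by
      obtain ⟨k, -, hk⟩ := Finset.mem_image.mp
        (Finset.orderEmbOfFin_mem (Finset.univ.image p) hcard i)
      rw [← hk, hre _ (hp k), hsin _ _ (hpk k), Real.sin_nat_mul_pi]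
      simp)
  obtain ⟨x, hx', hxv⟩ := hivt (Real.pi / 2) (by positivity) (by
    push_cast
    nlinarith [Real.pi_pos, (Nat.cast_nonneg n : (0 : ℝ) ≤ n)])
  have h3 := hall x
  rw [hre x hx', hsin x _ hxv, Real.sin_pi_div_two] at h3
  rcases hs1 with rfl | rfl <;> simp [Real.exp_ne_zero] at h3

/-! ### Vertical sides and the zero count of a rectangle -/

/-- The variation of the argument along a vertical segment on which `f` is close to
`A ζ ^ m exp (b ζ)`. -/
theorem abs_re_integral_logDeriv_sub_le {f : ℂ → ℂ} (hf : Differentiable ℂ f) {A : ℂ} {m : ℕ}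
    {b x t₁ t₂ : ℝ} (ht : t₁ ≤ t₂) (ht0 : ∀ t ∈ Set.Icc t₁ t₂, t ≠ 0) (hA : A ≠ 0)
    (hfA : ∀ t ∈ Set.Icc t₁ t₂, ∀ ζ : ℂ, ζ = x + t * Complex.I →
      ‖f ζ - A * ζ ^ m * Complex.exp (b * ζ)‖ ≤ ‖A * ζ ^ m * Complex.exp (b * ζ)‖ / 2) :
    |(∫ t in t₁..t₂, logDeriv f (x + t * Complex.I)).re - b * (t₂ - t₁)| ≤
      2 * Real.pi * (m + 1) := by
  set g : ℂ → ℂ := fun ζ => A * ζ ^ m * Complex.exp (b * ζ) with hg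
  set u : ℂ → ℂ := fun ζ => f ζ / g ζ with hu
  have hζ0 : ∀ t ∈ Set.Icc t₁ t₂, (x + t * Complex.I : ℂ) ≠ 0 := fun t ht' h =>
    ht0 t ht' (by simpa using congrArg Complex.im h)
  have hg0 : ∀ t ∈ Set.Icc t₁ t₂, g (x + t * Complex.I) ≠ 0 := fun t ht' =>
    mul_ne_zero (mul_ne_zero hA (pow_ne_zero _ (hζ0 t ht'))) (Complex.exp_ne_zero _)
  have hure : ∀ t ∈ Set.Icc t₁ t₂, 0 < (u (x + t * Complex.I)).re := by
    intro t ht'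
    have h1 : ‖u (x + t * Complex.I) - 1‖ ≤ 1 / 2 := by
      rw [hu, div_sub_one (hg0 t ht'), norm_div, div_le_iff₀ (norm_pos_iff.mpr (hg0 t ht'))]
      have := hfA t ht' _ rfl
      linarith
    have h2 := (abs_le.mp ((Complex.abs_re_le_norm _).trans h1)).1
    simp only [Complex.sub_re, Complex.one_re] at h2
    linarith
  have hf0 : ∀ t ∈ Set.Icc t₁ t₂, f (x + t * Complex.I) ≠ 0 := fun t ht' h => by
    have := hure t ht'
    simp [hu, h] at this
  -- A primitive of f'/f made of principal logarithms. The segment avoids the real axis, hence the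
  -- cut of log ζ, and u stays in the disc |u - 1| ≤ 1/2, hence in the right half-plane. The term bζ
  -- gives the main part, and the arguments cost at most 2πm + 2π.
  set G : ℂ → ℂ := fun ζ => b * ζ + (m * Complex.log ζ + Complex.log (u ζ)) with hG
  have hGd : ∀ t ∈ Set.Icc t₁ t₂,
      HasDerivAt G (logDeriv f (x + t * Complex.I)) (x + t * Complex.I) := by
    intro t ht'
    set ζ : ℂ := x + t * Complex.I with hζ
    have hs : ζ ∈ Complex.slitPlane := Complex.mem_slitPlane_iff.mpr (Or.inr (by
      simpa [hζ] using ht0 t ht'))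
    have hζ0' : ζ ≠ 0 := hζ0 t ht'
    have hg' : HasDerivAt g (g ζ * (m / ζ + b)) ζ := by
      have h1 : HasDerivAt (fun ζ : ℂ => Complex.exp (b * ζ)) (Complex.exp (b * ζ) * b) ζ := by
        simpa using ((hasDerivAt_id ζ).const_mul (b : ℂ)).cexp
      refine (((hasDerivAt_pow m ζ).const_mul A).mul h1).congr_deriv ?_
      rcases m with _ | k
      · simp [hg]
        ring
      · simp only [hg, Nat.add_sub_cancel]
        field_simp
        ring
    have hu' := ((hf ζ).hasDerivAt.div hg' (hg0 t ht')).clog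
      (Complex.mem_slitPlane_iff.mpr (Or.inl (hure t ht')))
    refine (((hasDerivAt_id ζ).const_mul (b : ℂ)).add
      (((Complex.hasDerivAt_log hs).const_mul (m : ℂ)).add hu')).congr_deriv ?_
    have h1 := hg0 t ht'
    have h2 := hf0 t ht'
    rw [← hζ] at h1 h2
    simp only [logDeriv_apply, Pi.div_apply]
    field_simp
    ring
  have key := intervalIntegral_eq_sub_of_antideriv_vertical ht hGd
    (continuousOn_logDeriv hf (g := fun t : ℝ => x + t * Complex.I) (by fun_prop) hf0)
  have him := congrArg Complex.im key
  simp only [hG, Complex.sub_im, Complex.add_im, Complex.log_im, Complex.ofReal_re,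
    Complex.ofReal_im, Complex.mul_im, Complex.I_re, Complex.I_im, Complex.natCast_re,
    Complex.natCast_im, zero_mul, one_mul, mul_one, mul_zero, zero_add, add_zero] at him
  rw [him]
  have b1 := Complex.abs_arg_le_pi (x + t₁ * Complex.I)
  have b2 := Complex.abs_arg_le_pi (x + t₂ * Complex.I)
  have b3 := Complex.abs_arg_le_pi (u (x + t₁ * Complex.I))
  have b4 := Complex.abs_arg_le_pi (u (x + t₂ * Complex.I))
  rw [abs_le] at *
  have hm : (0 : ℝ) ≤ m := Nat.cast_nonneg m
  constructor <;> nlinarith [mul_le_mul_of_nonneg_left b1.1 hm, mul_le_mul_of_nonneg_left b1.2 hm,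
    mul_le_mul_of_nonneg_left b2.1 hm, mul_le_mul_of_nonneg_left b2.2 hm]

/-- The number of zeros of an exponential polynomial in a rectangle whose vertical sides lie in
regions where a single term of it dominates. -/
theorem abs_zeroCount_rect_sub_le {F : Finset ℝ} {P : ℝ → Polynomial ℂ} {A₀ A₁ : ℂ} {m₀ m₁ : ℕ}
    {b₀ b₁ x₀ x₁ t₁ t₂ : ℝ} (hx : x₀ < x₁) (ht : t₁ < t₂) (ht0 : ∀ t ∈ Set.Icc t₁ t₂, t ≠ 0)
    (hA₀ : A₀ ≠ 0) (hA₁ : A₁ ≠ 0)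
    (hl : ∀ ζ : ℂ, ζ.re = x₀ → ζ.im ∈ Set.Icc t₁ t₂ →
      ‖expPoly F P ζ - A₀ * ζ ^ m₀ * Complex.exp (b₀ * ζ)‖ ≤
        ‖A₀ * ζ ^ m₀ * Complex.exp (b₀ * ζ)‖ / 2)
    (hr : ∀ ζ : ℂ, ζ.re = x₁ → ζ.im ∈ Set.Icc t₁ t₂ →
      ‖expPoly F P ζ - A₁ * ζ ^ m₁ * Complex.exp (b₁ * ζ)‖ ≤
        ‖A₁ * ζ ^ m₁ * Complex.exp (b₁ * ζ)‖ / 2)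
    (hh : ∀ ζ : ℂ, ζ.re ∈ Set.Icc x₀ x₁ → ζ.im = t₁ ∨ ζ.im = t₂ → expPoly F P ζ ≠ 0) :
    |2 * Real.pi * zeroCount (expPoly F P) (Set.Icc x₀ x₁ ×ℂ Set.Icc t₁ t₂) -
      (b₁ - b₀) * (t₂ - t₁)| ≤
      2 * Real.pi * (∑ b ∈ F, ((P b).natDegree + 1) + m₀ + m₁ + 3) := by
  set f := expPoly F P with hfdef
  have hf : Differentiable ℂ f := differentiable_expPoly F P
  have hne : ∀ (A : ℂ) (m : ℕ) (b : ℝ) (ζ : ℂ), A ≠ 0 → ζ.im ∈ Set.Icc t₁ t₂ →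
      ‖f ζ - A * ζ ^ m * Complex.exp (b * ζ)‖ ≤ ‖A * ζ ^ m * Complex.exp (b * ζ)‖ / 2 →
      f ζ ≠ 0 := by
    intro A m b ζ hA hζ h h0
    have hζ0 : ζ ≠ 0 := fun h => ht0 _ hζ (by simp [h])
    have hpos : 0 < ‖A * ζ ^ m * Complex.exp (b * ζ)‖ := norm_pos_iff.mpr
      (mul_ne_zero (mul_ne_zero hA (pow_ne_zero _ hζ0)) (Complex.exp_ne_zero _))
    rw [h0, zero_sub, norm_neg] at h
    linarith
  have harg := rectIntegral_logDeriv hf hx ht (fun z hz => by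
    obtain ⟨hz1, hz2⟩ := hz
    rw [Complex.mem_reProdIm] at hz1
    rcases hz2 with h | h | h | h
    · exact hne _ _ _ z hA₀ hz1.2 (hl z h hz1.2)
    · exact hne _ _ _ z hA₁ hz1.2 (hr z h hz1.2)
    · exact hh z hz1.1 (Or.inl h)
    · exact hh z hz1.1 (Or.inr h))
  have him := congrArg Complex.im harg
  have hdeg : ∀ b ∈ F, (P b).degree < (((P b).natDegree + 1 : ℕ) : WithBot ℕ) := fun b _ =>
    Polynomial.degree_le_natDegree.trans_lt (by exact_mod_cast Nat.lt_succ_self _)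
  have c1 := abs_im_integral_logDeriv_le (F := F) (P := P) hdeg (t := t₁) hx.le fun x hx' =>
    hh _ (by simpa using hx') (by simp)
  have c2 := abs_im_integral_logDeriv_le (F := F) (P := P) hdeg (t := t₂) hx.le fun x hx' =>
    hh _ (by simpa using hx') (by simp)
  have c3 := abs_re_integral_logDeriv_sub_le hf (A := A₀) (m := m₀) (b := b₀) (x := x₀) ht.le ht0
    hA₀ fun t ht' ζ hζ => hl ζ (by simp [hζ]) (by simpa [hζ] using ht')
  have c4 := abs_re_integral_logDeriv_sub_le hf (A := A₁) (m := m₁) (b := b₁) (x := x₁) ht.le ht0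
    hA₁ fun t ht' ζ hζ => hr ζ (by simp [hζ]) (by simpa [hζ] using ht')
  have hR : (2 * Real.pi * Complex.I *
      (zeroCount f (Set.Icc x₀ x₁ ×ℂ Set.Icc t₁ t₂) : ℂ)).im =
      2 * Real.pi * zeroCount f (Set.Icc x₀ x₁ ×ℂ Set.Icc t₁ t₂) := by
    simp
  rw [hR] at him
  simp only [rectIntegral, Complex.sub_im, Complex.add_im, Complex.I_mul_im] at him
  rw [← him]
  -- With n the sum of the degree bounds, the horizontal sides give at most 2π(n + 1) together, and
  -- the vertical sides at most 2π(m₀ + 1) and 2π(m₁ + 1). This explains the final 3.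
  push_cast at c1 c2 ⊢
  rw [abs_le] at *
  constructor <;> linarith [Real.pi_pos, c1.1, c1.2, c2.1, c2.2, c3.1, c3.2, c4.1, c4.2]

/-! ### Zones where a single term dominates -/

/-- For ζ ≠ 0 the quotient is the reversed polynomial at ζ⁻¹, which is continuous at 0 and has the
leading coefficient as its value there. -/
theorem tendsto_eval_div_pow_natDegree (p : Polynomial ℂ) :
    Tendsto (fun ζ => p.eval ζ / ζ ^ p.natDegree) (Bornology.cobounded ℂ) (𝓝 p.leadingCoeff) := by
  have h1 : Tendsto (fun ζ : ℂ => p.reverse.eval ζ⁻¹) (Bornology.cobounded ℂ)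
      (𝓝 (p.reverse.eval 0)) :=
    (p.reverse.continuous.tendsto 0).comp tendsto_inv₀_cobounded
  rw [← Polynomial.coeff_zero_eq_eval_zero, Polynomial.coeff_zero_reverse] at h1
  refine h1.congr' ?_
  filter_upwards [Bornology.eventually_ne_cobounded (0 : ℂ)] with ζ hζ
  let _ := invertibleOfNonzero hζ
  have := Polynomial.eval₂_reverse_mul_pow (RingHom.id ℂ) ζ p
  rw [invOf_eq_inv] at this
  rw [eq_div_iff (pow_ne_zero _ hζ)]
  exact this

theorem norm_pow_mul_exp {d : ℕ} {b : ℝ} {ζ : ℂ} (hζ : ζ ≠ 0) :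
    ‖ζ ^ d * Complex.exp (b * ζ)‖ = Real.exp (d * Real.log ‖ζ‖ + b * ζ.re) := by
  rw [norm_mul, norm_pow, Complex.norm_exp, Real.exp_add, Complex.re_ofReal_mul, 
    Real.exp_nat_mul, Real.exp_log (norm_pos_iff.mpr hζ)]

/-- The asymptotics of an exponential polynomial where one of its terms dominates. -/
theorem tendsto_expPoly_div {F : Finset ℝ} {P : ℝ → Polynomial ℂ} {v : ℝ} (hv : v ∈ F)
    (hPv : P v ≠ 0) {l : Filter ℂ} (hl : l ≤ Bornology.cobounded ℂ)
    (h : ∀ b ∈ F, b ≠ v → Tendsto (fun ζ : ℂ =>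
      (((P b).natDegree : ℝ) - (P v).natDegree) * Real.log ‖ζ‖ + (b - v) * ζ.re) l atBot) :
    Tendsto (fun ζ => expPoly F P ζ /
      ((P v).leadingCoeff * ζ ^ (P v).natDegree * Complex.exp (v * ζ))) l (𝓝 1) := by
  have hlc : (P v).leadingCoeff ≠ 0 := Polynomial.leadingCoeff_ne_zero.mpr hPv
  have hne : ∀ᶠ ζ : ℂ in l, ζ ≠ 0 := hl (Bornology.eventually_ne_cobounded (0 : ℂ))
  have hterm : ∀ b ∈ F, Tendsto (fun ζ : ℂ => (P b).eval ζ / ζ ^ (P b).natDegree *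
      (ζ ^ (P b).natDegree * Complex.exp (b * ζ) /
        ((P v).leadingCoeff * ζ ^ (P v).natDegree * Complex.exp (v * ζ)))) l
      (𝓝 (if b = v then 1 else 0)) := by
    intro b hb
    have h1 := (tendsto_eval_div_pow_natDegree (P b)).mono_left hl
    split_ifs with hbv
    · subst hbv
      rw [← mul_inv_cancel₀ hlc]
      refine h1.mul (tendsto_const_nhds.congr' ?_)
      filter_upwards [hne] with ζ hζ
      have := Complex.exp_ne_zero (b * ζ)
      field_simp
    · rw [← mul_zero (P b).leadingCoeff]
      refine h1.mul ?_
      rw [tendsto_zero_iff_norm_tendsto_zero]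
      have h2 := (Real.tendsto_exp_atBot.comp (h b hb hbv)).const_mul ‖(P v).leadingCoeff‖⁻¹
      rw [mul_zero] at h2
      refine h2.congr' ?_
      filter_upwards [hne] with ζ hζ
      rw [norm_div, mul_assoc, norm_pow_mul_exp hζ, norm_mul, norm_pow_mul_exp hζ, mul_comm ‖_‖,
        ← div_div, ← Real.exp_sub, div_eq_inv_mul, Function.comp]
      congr 2
      ring
  have hsum := tendsto_finsetSum F hterm
  rw [Finset.sum_ite_eq' F v, if_pos hv] at hsum
  refine hsum.congr' ?_
  filter_upwards [hne] with ζ hζ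
  rw [expPoly, Finset.sum_div]
  refine Finset.sum_congr rfl fun b _ => ?_
  have := pow_ne_zero (P b).natDegree hζ
  field_simp

/-- `f` is close to `A ζ ^ m exp (b ζ)` at `ζ`. -/
def DominatedBy (f : ℂ → ℂ) (A : ℂ) (m : ℕ) (b : ℝ) (ζ : ℂ) : Prop :=
  ‖f ζ - A * ζ ^ m * Complex.exp (b * ζ)‖ ≤ ‖A * ζ ^ m * Complex.exp (b * ζ)‖ / 2

theorem DominatedBy.ne_zero {f : ℂ → ℂ} {A : ℂ} {m : ℕ} {b : ℝ} {ζ : ℂ}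
    (h : DominatedBy f A m b ζ) (hA : A ≠ 0) (hζ : ζ ≠ 0) : f ζ ≠ 0 := by
  intro h0
  have hpos : 0 < ‖A * ζ ^ m * Complex.exp (b * ζ)‖ := norm_pos_iff.mpr
    (mul_ne_zero (mul_ne_zero hA (pow_ne_zero _ hζ)) (Complex.exp_ne_zero _))
  rw [DominatedBy, h0, zero_sub, norm_neg] at h
  linarith

theorem eventually_dominatedBy {F : Finset ℝ} {P : ℝ → Polynomial ℂ} {v : ℝ} (hv : v ∈ F)
    (hPv : P v ≠ 0) {l : Filter ℂ} (hl : l ≤ Bornology.cobounded ℂ)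
    (h : ∀ b ∈ F, b ≠ v → Tendsto (fun ζ : ℂ =>
      (((P b).natDegree : ℝ) - (P v).natDegree) * Real.log ‖ζ‖ + (b - v) * ζ.re) l atBot) :
    ∀ᶠ ζ in l, DominatedBy (expPoly F P) (P v).leadingCoeff (P v).natDegree v ζ := by
  have hlc : (P v).leadingCoeff ≠ 0 := Polynomial.leadingCoeff_ne_zero.mpr hPv
  have h1 := (tendsto_expPoly_div hv hPv hl h).eventually
    (Metric.closedBall_mem_nhds (1 : ℂ) (by norm_num : (0 : ℝ) < 1 / 2))
  filter_upwards [h1, hl (Bornology.eventually_ne_cobounded (0 : ℂ))] with ζ hζ hζ0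
  have hpos : (P v).leadingCoeff * ζ ^ (P v).natDegree * Complex.exp (v * ζ) ≠ 0 :=
    mul_ne_zero (mul_ne_zero hlc (pow_ne_zero _ hζ0)) (Complex.exp_ne_zero _)
  rw [dist_eq_norm, div_sub_one hpos, norm_div,
    div_le_iff₀ (norm_pos_iff.mpr hpos)] at hζ
  rw [DominatedBy]
  linarith

/-- For b < 0 and Re ζ ≥ 0 the factor e^{bζ} is at most 1 in modulus, and the degree gap supplies at
least one power of |ζ|⁻¹. -/
theorem exists_dominatedBy_right {F : Finset ℝ} {P : ℝ → Polynomial ℂ} (h0F : (0 : ℝ) ∈ F)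
    (hP0 : P 0 ≠ 0) (hF : ∀ b ∈ F, b ≠ 0 → b < 0 ∧ (P b).natDegree < (P 0).natDegree) :
    ∃ R₀ : ℝ, ∀ ζ : ℂ, 0 ≤ ζ.re → R₀ ≤ ‖ζ‖ →
      DominatedBy (expPoly F P) (P 0).leadingCoeff (P 0).natDegree 0 ζ := by
  have h := eventually_dominatedBy h0F hP0 (l := Bornology.cobounded ℂ ⊓ 𝓟 {ζ | 0 ≤ ζ.re})
    inf_le_left (fun b hb hb0 => by
      have h1 : Tendsto (fun ζ : ℂ => -Real.log ‖ζ‖)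
          (Bornology.cobounded ℂ ⊓ 𝓟 {ζ | 0 ≤ ζ.re}) atBot :=
        tendsto_neg_atTop_atBot.comp ((Real.tendsto_log_atTop.comp
          tendsto_norm_cobounded_atTop).mono_left inf_le_left)
      refine tendsto_atBot_mono' _ ?_ h1
      have h2 : ∀ᶠ ζ : ℂ in Bornology.cobounded ℂ, 1 ≤ ‖ζ‖ :=
        tendsto_norm_cobounded_atTop.eventually_ge_atTop 1
      filter_upwards [h2.filter_mono inf_le_left, mem_inf_of_right (mem_principal_self _)]
        with ζ hζ1 hζ2
      obtain ⟨hbneg, hdeg⟩ := hF b hb hb0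
      have h3 : ((P b).natDegree : ℝ) + 1 ≤ (P 0).natDegree := by exact_mod_cast hdeg
      have h4 := Real.log_nonneg hζ1
      have h5 : 0 ≤ ζ.re := hζ2
      nlinarith [mul_nonneg (neg_nonneg.mpr hbneg.le) h5])
  obtain ⟨R₀, -, hR⟩ := (hasBasis_cobounded_norm.inf_principal _).eventually_iff.mp h
  exact ⟨R₀, fun ζ h1 h2 => hR ⟨h2, h1⟩⟩

/-- On Re ζ = -μ log|Im ζ| the term of b is smaller than that of v by the power |Im ζ|^{δ b} up to
constants, with δ b > 0 by strict maximality. Thickening the curve by ε log|Im ζ| changes this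
exponent by at most |b - v|ε, and ε is chosen so small that half the gap survives for all of the
finitely many b. -/
theorem exists_dominatedBy_zone {F : Finset ℝ} {P : ℝ → Polynomial ℂ} {v μ : ℝ} (hv : v ∈ F)
    (hPv : P v ≠ 0) (hmax : ∀ b ∈ F, b ≠ v →
      ((P b).natDegree : ℝ) - μ * b < (P v).natDegree - μ * v) :
    ∃ ε > 0, ∃ T₀ : ℝ, ∀ ζ : ℂ, T₀ ≤ |ζ.im| →
      |ζ.re + μ * Real.log (|ζ.im|)| ≤ ε * Real.log |ζ.im| →
      DominatedBy (expPoly F P) (P v).leadingCoeff (P v).natDegree v ζ := by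
  set δ : ℝ → ℝ := fun b => ((P v).natDegree - μ * v) - ((P b).natDegree - μ * b) with hδ
  obtain ⟨ε, hε, hε0⟩ : ∃ ε : ℝ, (∀ b ∈ F, b ≠ v → |b - v| * ε < δ b / 2) ∧ 0 < ε := by
    have h1 : ∀ᶠ ε : ℝ in 𝓝[>] 0, ∀ b ∈ F, b ≠ v → |b - v| * ε < δ b / 2 := by
      refine (Filter.eventually_all_finset F).mpr fun b hb => ?_
      by_cases hbv : b = v
      · exact Eventually.of_forall fun _ h => absurd hbv h
      · have h2 : Tendsto (fun ε : ℝ => |b - v| * ε) (𝓝[>] 0) (𝓝 0) := by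
          have : Tendsto (fun ε : ℝ => |b - v| * ε) (𝓝 0) (𝓝 (|b - v| * 0)) :=
            (continuous_const.mul continuous_id).tendsto 0
          rw [mul_zero] at this
          exact this.mono_left nhdsWithin_le_nhds
        filter_upwards [h2.eventually_lt_const
          (show 0 < δ b / 2 by have := hmax b hb hbv; simp only [hδ]; linarith)] with ε h _
        exact h
    exact (h1.and self_mem_nhdsWithin).exists
  refine ⟨ε, hε0, ?_⟩
  set S : Set ℂ := {ζ | |ζ.re + μ * Real.log (|ζ.im|)| ≤ ε * Real.log |ζ.im|}
  set l : Filter ℂ := comap (fun ζ : ℂ => |ζ.im|) atTop ⊓ 𝓟 S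
  have him : Tendsto (fun ζ : ℂ => |ζ.im|) l atTop := tendsto_comap.mono_left inf_le_left
  have hlog : Tendsto (fun ζ : ℂ => Real.log |ζ.im|) l atTop := Real.tendsto_log_atTop.comp him
  have hlc : l ≤ Bornology.cobounded ℂ := by
    rw [← comap_norm_atTop, ← tendsto_iff_comap]
    exact tendsto_atTop_mono (fun ζ => Complex.abs_im_le_norm ζ) him
  have hS : ∀ᶠ ζ in l, ζ ∈ S := mem_inf_of_right (mem_principal_self _)
  -- In the zone |Re ζ| ≤ |Im ζ| eventually, so log|ζ| and log|Im ζ| differ by at most log 2 and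
  -- either may be used in the exponents.
  have hsmall : ∀ᶠ ζ in l, (|μ| + ε) * Real.log |ζ.im| ≤ |ζ.im| := by
    have := (Real.isLittleO_log_id_atTop.bound
      (show 0 < (|μ| + ε)⁻¹ by positivity))
    filter_upwards [him.eventually this, him.eventually_ge_atTop 1] with ζ hζ h1
    rw [Real.norm_of_nonneg (Real.log_nonneg h1), id, Real.norm_of_nonneg (by positivity)] at hζ
    rwa [← div_eq_inv_mul, le_div_iff₀' (by positivity)] at hζ
  have h := eventually_dominatedBy hv hPv hlc (fun b hb hbv => by
    have h1 : Tendsto (fun ζ : ℂ => -(δ b / 2) * Real.log |ζ.im| +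
        |((P b).natDegree : ℝ) - (P v).natDegree| * Real.log 2) l atBot := by
      refine tendsto_atBot_add_const_right _ _ (hlog.const_mul_atTop_of_neg ?_)
      have := hmax b hb hbv
      simp only [hδ]
      linarith
    refine tendsto_atBot_mono' _ ?_ h1
    filter_upwards [hS, hsmall, him.eventually_ge_atTop 1] with ζ hζS hζs hζ1
    set L := Real.log |ζ.im| with hL
    have hL0 : 0 ≤ L := Real.log_nonneg hζ1
    have hζS' : |ζ.re + μ * L| ≤ ε * L := hζS
    have hre : |ζ.re| ≤ |ζ.im| := by
      calc |ζ.re| = |(ζ.re + μ * L) - μ * L| := by ring_nf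
        _ ≤ |ζ.re + μ * L| + |μ * L| := abs_sub _ _
        _ ≤ ε * L + |μ| * L := by
          rw [abs_mul μ, abs_of_nonneg hL0]
          gcongr
        _ ≤ |ζ.im| := by linarith
    have hn1 : |ζ.im| ≤ ‖ζ‖ := Complex.abs_im_le_norm ζ
    have hn2 : ‖ζ‖ ≤ 2 * |ζ.im| := (Complex.norm_le_abs_re_add_abs_im ζ).trans (by linarith)
    have hl1 : L ≤ Real.log ‖ζ‖ := Real.log_le_log (by linarith) hn1
    have hl2 : Real.log ‖ζ‖ ≤ Real.log 2 + L := by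
      rw [hL, ← Real.log_mul (by norm_num) (by linarith)]
      exact Real.log_le_log (by linarith) hn2
    have e1 : (((P b).natDegree : ℝ) - (P v).natDegree) * (Real.log ‖ζ‖ - L) ≤
        |((P b).natDegree : ℝ) - (P v).natDegree| * Real.log 2 := by
      refine (le_abs_self _).trans ?_
      rw [abs_mul, abs_of_nonneg (sub_nonneg.mpr hl1)]
      gcongr
      linarith
    have e2 : (b - v) * (ζ.re + μ * L) ≤ δ b / 2 * L := by
      refine (le_abs_self _).trans ?_
      rw [abs_mul]
      calc |b - v| * |ζ.re + μ * L| ≤ |b - v| * (ε * L) := by gcongr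
        _ = |b - v| * ε * L := by ring
        _ ≤ δ b / 2 * L := by
          have := (hε b hb hbv).le
          gcongr
    have e3 : (((P b).natDegree : ℝ) - (P v).natDegree) * L - (b - v) * (μ * L) = -(δ b * L) := by
      simp only [hδ]; ring
    linarith)
  obtain ⟨T₀, -, hT⟩ := ((atTop_basis.comap _).inf_principal S).eventually_iff.mp h
  exact ⟨T₀, fun ζ h1 h2 => hT ⟨h1, h2⟩⟩

theorem expPoly_ne_zero_fun {F : Finset ℝ} {P : ℝ → Polynomial ℂ} (h0F : (0 : ℝ) ∈ F)
    (hP0 : P 0 ≠ 0) (hF : ∀ b ∈ F, b ≠ 0 → b < 0 ∧ (P b).natDegree < (P 0).natDegree) :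
    expPoly F P ≠ 0 := by
  obtain ⟨R₀, hR⟩ := exists_dominatedBy_right h0F hP0 hF
  intro h
  have hpos : (0 : ℝ) < max R₀ 1 := lt_max_of_lt_right one_pos
  refine (hR ((max R₀ 1 : ℝ) : ℂ) (by simp) ?_).ne_zero
    (Polynomial.leadingCoeff_ne_zero.mpr hP0) (by exact_mod_cast hpos.ne') (by simp [h])
  rw [Complex.norm_real, Real.norm_of_nonneg hpos.le]
  exact le_max_left _ _

/-! ### Density of zeros in logarithmic regions -/

/-- The part of a logarithmic strip with `s < σ Im ζ ≤ T`. -/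
def logStrip (σ μ s T : ℝ) : Set ℂ :=
  {ζ | -μ * Real.log (|ζ.im| + 1) ≤ ζ.re ∧ ζ.re ≤ 0 ∧ s < σ * ζ.im ∧ σ * ζ.im ≤ T}

/-- The logarithmic region of radius `R`. -/
def logRegion (μ R : ℝ) : Set ℂ :=
  {ζ | -μ * Real.log (|ζ.im| + 1) ≤ ζ.re ∧ ‖ζ‖ ≤ R}

theorem isBounded_logRegion (μ R : ℝ) : Bornology.IsBounded (logRegion μ R) :=
  (Metric.isBounded_closedBall (x := (0 : ℂ)) (r := R)).subset fun ζ hζ => by simpa using hζ.2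

theorem abs_eq_sign_mul {σ x : ℝ} (hσ : σ = 1 ∨ σ = -1) (h : 0 ≤ σ * x) : |x| = σ * x := by
  rcases hσ with rfl | rfl
  · rw [one_mul] at h ⊢
    exact abs_of_nonneg h
  · rw [neg_one_mul] at h ⊢
    exact abs_of_nonpos (by linarith)

theorem isBounded_of_log_le {μ T : ℝ} {S : Set ℂ}
    (h : ∀ ζ ∈ S, -μ * Real.log (|ζ.im| + 1) ≤ ζ.re ∧ ζ.re ≤ 0 ∧ |ζ.im| ≤ T) :
    Bornology.IsBounded S := by
  refine ((isCompact_Icc (a := -|μ| * Real.log (T + 1)) (b := 0)).reProdIm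
    (isCompact_Icc (a := -T) (b := T))).isBounded.subset fun ζ hζ => ?_
  obtain ⟨h1, h2, h3⟩ := h ζ hζ
  rw [Complex.mem_reProdIm]
  refine ⟨⟨?_, h2⟩, abs_le.mp h3⟩
  have h4 : 0 ≤ Real.log (|ζ.im| + 1) := Real.log_nonneg (by linarith [abs_nonneg ζ.im])
  have h5 : Real.log (|ζ.im| + 1) ≤ Real.log (T + 1) :=
    Real.log_le_log (by positivity) (by linarith)
  have h6 : μ * Real.log (|ζ.im| + 1) ≤ |μ| * Real.log (T + 1) :=
    mul_le_mul (le_abs_self μ) h5 h4 (abs_nonneg μ)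
  linarith

theorem isBounded_logStrip {σ : ℝ} (hσ : σ = 1 ∨ σ = -1) (μ : ℝ) {s : ℝ} (hs : 0 ≤ s) (T : ℝ) :
    Bornology.IsBounded (logStrip σ μ s T) :=
  isBounded_of_log_le (μ := μ) (T := T) fun ζ hζ =>
    ⟨hζ.1, hζ.2.1, by rw [abs_eq_sign_mul hσ (hs.trans hζ.2.2.1.le)]; exact hζ.2.2.2⟩

/-- This allows a horizontal side to be shifted slightly upward (in the direction of σ) off the
zeros without any zero being gained or lost. -/
theorem eventually_forall_gap {Z : Set ℂ} (hZ : Z.Finite) (σ s : ℝ) :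
    ∀ᶠ η : ℝ in 𝓝[>] 0, ∀ ζ ∈ Z, σ * ζ.im ≤ s + η → σ * ζ.im ≤ s := by
  refine (hZ.eventually_all).mpr fun ζ _ => ?_
  by_cases h : σ * ζ.im ≤ s
  · exact Eventually.of_forall fun _ _ => h
  · have : ∀ᶠ η : ℝ in 𝓝[>] 0, η < σ * ζ.im - s :=
      nhdsWithin_le_nhds (eventually_lt_nhds (by linarith))
    filter_upwards [this] with η hη h'
    linarith

/-- The curved left edge may be replaced by the straight line Re ζ = -μ log T: on this range of
heights both lie in the zone where the term of v dominates, so no zero lies between them. What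
remains is the rectangle count, with v dominant on the left and 0 on the right. -/
theorem exists_abs_zeroCount_logStrip_le {F : Finset ℝ} {P : ℝ → Polynomial ℂ}
    (h0F : (0 : ℝ) ∈ F) (hP0 : P 0 ≠ 0)
    (hF : ∀ b ∈ F, b ≠ 0 → b < 0 ∧ (P b).natDegree < (P 0).natDegree) {v μ : ℝ} (hμ : 0 < μ)
    (hv : v ∈ F) (hPv : P v ≠ 0) (hmax : ∀ b ∈ F, b ≠ v →
      ((P b).natDegree : ℝ) - μ * b < (P v).natDegree - μ * v) {σ : ℝ} (hσ : σ = 1 ∨ σ = -1) :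
    ∃ C T₁ : ℝ, 0 < T₁ ∧ ∀ T, T₁ ≤ T →
      |2 * Real.pi * zeroCount (expPoly F P) (logStrip σ μ (T / 2) T) + v * (T / 2)| ≤ C := by
  have hne := expPoly_ne_zero_fun h0F hP0 hF
  have hf := differentiable_expPoly F P
  obtain ⟨R₀, hR₀⟩ := exists_dominatedBy_right h0F hP0 hF
  obtain ⟨ε, hε, T₀, hT₀⟩ := exists_dominatedBy_zone hv hPv hmax
  have hlog : ∀ᶠ T : ℝ in atTop, μ * Real.log 4 / ε ≤ Real.log (T / 2) :=
    (Real.tendsto_log_atTop.comp (tendsto_id.atTop_div_const two_pos)).eventually_ge_atTop _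
  obtain ⟨T₂, hT₂⟩ := (hlog.and ((eventually_ge_atTop (2 * T₀)).and
    ((eventually_ge_atTop (2 * R₀)).and (eventually_ge_atTop 2)))).exists_forall_of_atTop
  refine ⟨2 * Real.pi * (∑ b ∈ F, ((P b).natDegree + 1 : ℝ) + (P v).natDegree +
    (P 0).natDegree + 3), max T₂ 1, lt_max_of_lt_right one_pos, fun T hT => ?_⟩
  obtain ⟨hTlog, hTT₀, hTR₀, hT2⟩ := hT₂ T (le_of_max_le_left hT)
  -- For T ≥ 2 one has T + 2 ≤ 4(T/2), so all these abscissas differ from -μ log|Im ζ| by at most μ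
  -- log 4, which ε log(T/2) exceeds for large T.
  have hzone : ∀ ζ : ℂ, T / 2 ≤ |ζ.im| → |ζ.im| ≤ T + 1 → -μ * Real.log (T + 2) ≤ ζ.re →
      ζ.re ≤ -μ * Real.log (T / 2) →
      DominatedBy (expPoly F P) (P v).leadingCoeff (P v).natDegree v ζ := by
    intro ζ h1 h2 h3 h4
    refine hT₀ ζ (by linarith) ?_
    have l1 : Real.log (T / 2) ≤ Real.log |ζ.im| := Real.log_le_log (by linarith) h1
    have l2 : Real.log |ζ.im| ≤ Real.log (T + 2) := Real.log_le_log (by linarith) (by linarith)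
    have l3 : Real.log (T + 2) ≤ Real.log (T / 2) + Real.log 4 := by
      rw [← Real.log_mul (by linarith) (by norm_num)]
      exact Real.log_le_log (by linarith) (by linarith)
    have l4 : μ * Real.log 4 ≤ ε * Real.log |ζ.im| := by
      rw [div_le_iff₀ hε] at hTlog
      nlinarith
    rw [abs_le]
    constructor <;> nlinarith
  have hlogT : 0 < Real.log T := Real.log_pos (by linarith)
  have m1 : μ * Real.log (T / 2) ≤ μ * Real.log T :=
    mul_le_mul_of_nonneg_left (Real.log_le_log (by linarith) (by linarith)) hμ.le
  have m2 : μ * Real.log T ≤ μ * Real.log (T + 2) :=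
    mul_le_mul_of_nonneg_left (Real.log_le_log (by linarith) (by linarith)) hμ.le
  set K : Set ℂ := Set.Icc (-μ * Real.log (T + 2)) 0 ×ℂ Set.Icc (-(T + 1)) (T + 1)
  have hK : (K ∩ {z | expPoly F P z = 0}).Finite := finite_zeros_of_isBounded hf hne
    (isCompact_Icc.reProdIm isCompact_Icc).isBounded
  have hη1' : ∀ᶠ η : ℝ in 𝓝[>] 0, η < 1 := nhdsWithin_le_nhds (eventually_lt_nhds one_pos)
  obtain ⟨η, hη1, hη2, hη3, hη0⟩ := ((eventually_forall_gap hK σ (T / 2)).and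
    ((eventually_forall_gap hK σ T).and (hη1'.and self_mem_nhdsWithin))).exists
  have hη0 : 0 < η := hη0
  have hmemK : ∀ ζ : ℂ, -μ * Real.log (T + 2) ≤ ζ.re → ζ.re ≤ 0 → 0 ≤ σ * ζ.im →
      σ * ζ.im ≤ T + 1 → ζ ∈ K := by
    intro ζ h1 h2 h3 h4
    rw [Complex.mem_reProdIm]
    exact ⟨⟨h1, h2⟩, abs_le.mp (by rw [abs_eq_sign_mul hσ h3]; exact h4)⟩
  -- The heights from T/2 + η to T + η, reflected to negative ordinates when σ = -1.
  obtain ⟨t₁, t₂, ht, htT, hmem, hend⟩ : ∃ t₁ t₂ : ℝ, t₁ < t₂ ∧ t₂ - t₁ = T / 2 ∧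
      (∀ t, t ∈ Set.Icc t₁ t₂ ↔ T / 2 + η ≤ σ * t ∧ σ * t ≤ T + η) ∧
      ∀ t, t = t₁ ∨ t = t₂ → σ * t = T / 2 + η ∨ σ * t = T + η := by
    rcases hσ with rfl | rfl
    · refine ⟨T / 2 + η, T + η, by linarith, by ring, fun t => by simp, fun t => by simp⟩
    · refine ⟨-(T + η), -(T / 2 + η), by linarith, by ring, fun t => ?_, ?_⟩
      · rw [Set.mem_Icc]
        constructor <;> rintro ⟨a, b⟩ <;> constructor <;> linarith
      · rintro t (rfl | rfl)
        · right; ring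
        · left; ring
  have habs : ∀ t ∈ Set.Icc t₁ t₂, T / 2 + η ≤ |t| ∧ |t| ≤ T + η := fun t h => by
    have h' := (hmem t).mp h
    rw [abs_eq_sign_mul hσ (by linarith)]
    exact h'
  have hrect := abs_zeroCount_rect_sub_le (F := F) (P := P) (x₀ := -μ * Real.log T) (x₁ := 0)
    (A₀ := (P v).leadingCoeff) (m₀ := (P v).natDegree) (b₀ := v)
    (A₁ := (P 0).leadingCoeff) (m₁ := (P 0).natDegree) (b₁ := 0)
    (by nlinarith) ht
    (fun t h h0 => by have := habs t h; rw [h0, abs_zero] at this; linarith [this.1])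
    (Polynomial.leadingCoeff_ne_zero.mpr hPv) (Polynomial.leadingCoeff_ne_zero.mpr hP0)
    (fun ζ h1 h2 => by
      have h3 := habs _ h2
      exact hzone ζ (by linarith) (by linarith) (by rw [h1]; linarith) (by rw [h1]; linarith))
    (fun ζ h1 h2 => by
      have h3 := habs _ h2
      exact hR₀ ζ h1.ge (by linarith [Complex.abs_im_le_norm ζ]))
    (fun ζ h1 h2 h0 => by
      rcases hend _ h2 with h | h
      · have hζK := hmemK ζ (by linarith [h1.1]) h1.2 (by linarith) (by linarith)
        have := hη1 ζ ⟨hζK, h0⟩ h.le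
        linarith
      · have hζK := hmemK ζ (by linarith [h1.1]) h1.2 (by linarith) (by linarith)
        have := hη2 ζ ⟨hζK, h0⟩ h.le
        linarith)
  rw [zeroCount_congr hf hne (T := Set.Icc (-μ * Real.log T) 0 ×ℂ Set.Icc t₁ t₂)]
  · rw [htT, show (0 - v) * (T / 2) = -(v * (T / 2)) by ring, sub_neg_eq_add] at hrect
    push_cast at hrect
    exact hrect
  · intro ζ h0
    rw [Complex.mem_reProdIm, hmem]
    constructor
    · rintro ⟨h1, h2, h3, h4⟩
      have ha : |ζ.im| = σ * ζ.im := abs_eq_sign_mul hσ (by linarith)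
      rw [ha] at h1
      have l1 : μ * Real.log (σ * ζ.im + 1) ≤ μ * Real.log (T + 2) :=
        mul_le_mul_of_nonneg_left (Real.log_le_log (by linarith) (by linarith)) hμ.le
      refine ⟨⟨?_, h2⟩, ?_, by linarith⟩
      · by_contra! hcon
        refine (hzone ζ (by linarith) (by linarith) (by linarith) (by linarith)).ne_zero
          (Polynomial.leadingCoeff_ne_zero.mpr hPv) (fun h => ?_) h0
        rw [h] at h3
        simp at h3
        linarith
      · by_contra! hcon
        have := hη1 ζ ⟨hmemK ζ (by linarith) h2 (by linarith) (by linarith), h0⟩ hcon.le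
        linarith
    · rintro ⟨⟨h1, h2⟩, h3, h4⟩
      have ha : |ζ.im| = σ * ζ.im := abs_eq_sign_mul hσ (by linarith)
      have hK' := hmemK ζ (by linarith) h2 (by linarith) (by linarith)
      refine ⟨?_, h2, by linarith, hη2 ζ ⟨hK', h0⟩ h4⟩
      by_contra! hcon
      rw [ha] at hcon
      have l1 : μ * Real.log (T / 2) ≤ μ * Real.log (σ * ζ.im + 1) :=
        mul_le_mul_of_nonneg_left (Real.log_le_log (by linarith) (by linarith)) hμ.le
      refine (hzone ζ (by linarith) (by linarith) (by linarith) (by linarith)).ne_zero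
        (Polynomial.leadingCoeff_ne_zero.mpr hPv) (fun h => ?_) h0
      rw [h] at h3
      simp at h3
      linarith

/-- Bounded dyadic increments give g(T) = O(log T), but the weaker bound O(√T) is easier to carry by
induction: since √(1/2) ≤ 3/4, halving T frees at least C√(T/T₁) ≥ C, which absorbs the increment.
-/
theorem tendsto_div_of_dyadic {g : ℝ → ℝ} {B C T₁ : ℝ} (hT₁ : 0 < T₁)
    (h0 : ∀ T, 0 < T → T ≤ T₁ → |g T| ≤ B) (h : ∀ T, T₁ ≤ T → |g T - g (T / 2)| ≤ C) :
    Tendsto (fun T => g T / T) atTop (𝓝 0) := by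
  have hC : 0 ≤ C := (abs_nonneg _).trans (h T₁ le_rfl)
  have key : ∀ n : ℕ, ∀ T, 0 < T → T ≤ 2 ^ n * T₁ → |g T| ≤ B + 4 * C * √(T / T₁) := by
    intro n
    induction n with
    | zero =>
      intro T hT hT'
      have := h0 T hT (by simpa using hT')
      have : 0 ≤ 4 * C * √(T / T₁) := by positivity
      linarith
    | succ n ih =>
      intro T hT hT'
      by_cases hc : T ≤ T₁
      · have := h0 T hT hc
        have : 0 ≤ 4 * C * √(T / T₁) := by positivity
        linarith
      · push Not at hc
        have h1 := ih (T / 2) (by linarith) (by rw [pow_succ] at hT'; linarith)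
        have h2 := h T hc.le
        have h3 : 1 ≤ √(T / T₁) := by
          rw [Real.one_le_sqrt, one_le_div hT₁]
          exact hc.le
        have h4 : √(T / 2 / T₁) ≤ 3 / 4 * √(T / T₁) := by
          rw [show (3 / 4 : ℝ) = √((3 / 4) ^ 2) by rw [Real.sqrt_sq (by norm_num)],
            ← Real.sqrt_mul (by norm_num)]
          refine Real.sqrt_le_sqrt ?_
          have : 0 < T / T₁ := by positivity
          rw [div_right_comm]
          linarith
        have h5 : |g T| ≤ |g (T / 2)| + |g T - g (T / 2)| := by
          calc |g T| = |g (T / 2) + (g T - g (T / 2))| := by ring_nf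
            _ ≤ _ := abs_add_le _ _
        nlinarith
  have hlim : Tendsto (fun T : ℝ => B / T + 4 * C * √T₁⁻¹ * (√T)⁻¹) atTop (𝓝 0) := by
    have h1 : Tendsto (fun T : ℝ => B / T) atTop (𝓝 0) := tendsto_const_nhds.div_atTop tendsto_id
    have h2 : Tendsto (fun T : ℝ => (√T)⁻¹) atTop (𝓝 0) :=
      tendsto_inv_atTop_zero.comp Real.tendsto_sqrt_atTop
    simpa using h1.add (h2.const_mul (4 * C * √T₁⁻¹))
  refine squeeze_zero_norm' ?_ hlim
  filter_upwards [eventually_gt_atTop 0] with T hT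
  obtain ⟨n, hn⟩ := pow_unbounded_of_one_lt (T / T₁) (one_lt_two (α := ℝ))
  have h1 := key n T hT ((div_le_iff₀ hT₁).mp hn.le)
  rw [norm_div, Real.norm_eq_abs, Real.norm_of_nonneg hT.le, div_le_iff₀ hT]
  have h2 : √(T / T₁) = √T₁⁻¹ * (√T)⁻¹ * T := by
    rw [div_eq_mul_inv, Real.sqrt_mul hT.le]
    have h3 := Real.mul_self_sqrt hT.le
    have h4 : √T ≠ 0 := (Real.sqrt_pos.mpr hT).ne'
    field_simp
    rw [sq, h3]
  rw [h2] at h1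
  refine h1.trans (le_of_eq ?_)
  field_simp

theorem zeroCount_logStrip_add {f : ℂ → ℂ} (hf : Differentiable ℂ f) (h0 : f ≠ 0) {σ μ s t T : ℝ}
    (hσ : σ = 1 ∨ σ = -1) (hs : 0 ≤ s) (hst : s ≤ t) (htT : t ≤ T) :
    zeroCount f (logStrip σ μ s T) =
      zeroCount f (logStrip σ μ s t) + zeroCount f (logStrip σ μ t T) := by
  rw [← zeroCount_union hf h0 (isBounded_logStrip hσ μ hs t)
    (isBounded_logStrip hσ μ (hs.trans hst) T)]
  · congr 1
    ext ζ
    constructor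
    · rintro ⟨h1, h2, h3, h4⟩
      rcases le_or_gt (σ * ζ.im) t with h | h
      · exact Or.inl ⟨h1, h2, h3, h⟩
      · exact Or.inr ⟨h1, h2, h, h4⟩
    · rintro (⟨h1, h2, h3, h4⟩ | ⟨h1, h2, h3, h4⟩)
      · exact ⟨h1, h2, h3, h4.trans htT⟩
      · exact ⟨h1, h2, hst.trans_lt h3, h4⟩
  · exact Set.disjoint_left.mpr fun ζ h h' => not_lt.mpr h.2.2.2 h'.2.2.1

/-- The statement holds for every S ≥ S₀ so that the upper and lower half-planes can share one
starting height. -/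
theorem exists_tendsto_zeroCount_logStrip {F : Finset ℝ} {P : ℝ → Polynomial ℂ}
    (h0F : (0 : ℝ) ∈ F) (hP0 : P 0 ≠ 0)
    (hF : ∀ b ∈ F, b ≠ 0 → b < 0 ∧ (P b).natDegree < (P 0).natDegree) {v μ : ℝ} (hμ : 0 < μ)
    (hv : v ∈ F) (hPv : P v ≠ 0) (hmax : ∀ b ∈ F, b ≠ v →
      ((P b).natDegree : ℝ) - μ * b < (P v).natDegree - μ * v) {σ : ℝ} (hσ : σ = 1 ∨ σ = -1) :
    ∃ S₀ : ℝ, 0 < S₀ ∧ ∀ S, S₀ ≤ S → Tendsto (fun T : ℝ =>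
      (zeroCount (expPoly F P) (logStrip σ μ S T) : ℝ) / T) atTop (𝓝 (-v / (2 * Real.pi))) := by
  have hne := expPoly_ne_zero_fun h0F hP0 hF
  have hf := differentiable_expPoly F P
  obtain ⟨C, S₀, hS₀, hC⟩ := exists_abs_zeroCount_logStrip_le h0F hP0 hF hμ hv hPv hmax hσ
  refine ⟨S₀, hS₀, fun S hS => ?_⟩
  have hS0 : 0 < S := hS₀.trans_le hS
  set G : ℝ → ℝ := fun T => zeroCount (expPoly F P) (logStrip σ μ S T) with hG
  -- The increment of 2πG(T) + vT over (T/2, T] is the quantity bounded in the previous estimate.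
  -- The threshold 2S ensures T/2 ≥ S, so that the strip can be cut at T/2.
  have h1 := tendsto_div_of_dyadic (g := fun T => 2 * Real.pi * G T + v * T) (C := C)
    (B := 2 * Real.pi * G (2 * S) + |v| * (2 * S)) (T₁ := 2 * S) (by linarith)
    (fun T hT hT' => by
      have hmono : G T ≤ G (2 * S) := by
        simp only [hG]
        refine Nat.cast_le.mpr (zeroCount_mono hf hne (isBounded_logStrip hσ μ hS0.le _) ?_)
        exact fun ζ hζ _ => ⟨hζ.1, hζ.2.1, hζ.2.2.1, hζ.2.2.2.trans hT'⟩
      have hnn : 0 ≤ G T := Nat.cast_nonneg _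
      refine (abs_add_le _ _).trans (add_le_add ?_ ?_)
      · rw [abs_of_nonneg (by positivity)]
        gcongr
      · rw [abs_mul, abs_of_pos hT]
        gcongr)
    (fun T hT => by
      have := hC T (by linarith)
      have hadd : G T = G (T / 2) + zeroCount (expPoly F P) (logStrip σ μ (T / 2) T) := by
        simp only [hG]
        exact_mod_cast zeroCount_logStrip_add hf hne hσ hS0.le (by linarith : S ≤ T / 2)
          (by linarith : T / 2 ≤ T)
      simp only [hadd]
      convert this using 2
      ring)
  have h2 := (h1.sub_const v).div_const (2 * Real.pi)
  rw [zero_sub] at h2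
  refine h2.congr' ?_
  filter_upwards [eventually_gt_atTop 0] with T hT
  field_simp
  ring

theorem tendsto_sub_log_div (μ : ℝ) :
    Tendsto (fun R : ℝ => (R - μ * Real.log (R + 1)) / R) atTop (𝓝 1) := by
  have h1 : Tendsto (fun R : ℝ => Real.log (R + 1) / (R + 1)) atTop (𝓝 0) :=
    (Real.isLittleO_log_id_atTop.tendsto_div_nhds_zero).comp
      (tendsto_atTop_add_const_right _ 1 tendsto_id)
  have h2 : Tendsto (fun R : ℝ => 1 + 1 / R) atTop (𝓝 (1 + 0)) :=
    tendsto_const_nhds.add (tendsto_const_nhds.div_atTop tendsto_id)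
  have h3 := ((h1.mul h2).const_mul μ).const_sub 1
  simp only [zero_mul, mul_zero, sub_zero] at h3
  refine h3.congr' ?_
  filter_upwards [eventually_gt_atTop 0] with R hR
  field_simp

/-- The density of the zeros of an exponential polynomial in a logarithmic region. -/
theorem tendsto_zeroCount_logRegion {F : Finset ℝ} {P : ℝ → Polynomial ℂ}
    (h0F : (0 : ℝ) ∈ F) (hP0 : P 0 ≠ 0)
    (hF : ∀ b ∈ F, b ≠ 0 → b < 0 ∧ (P b).natDegree < (P 0).natDegree) {v μ : ℝ}
    (hv : v ∈ F) (hPv : P v ≠ 0) (hmax : ∀ b ∈ F, b ≠ v →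
      ((P b).natDegree : ℝ) - μ * b < (P v).natDegree - μ * v) :
    Tendsto (fun R : ℝ => (zeroCount (expPoly F P) (logRegion μ R) : ℝ) / R) atTop
      (𝓝 (-v / Real.pi)) := by
  have hne := expPoly_ne_zero_fun h0F hP0 hF
  have hf := differentiable_expPoly F P
  obtain ⟨R₀, hR₀⟩ := exists_dominatedBy_right h0F hP0 hF
  set R₁ : ℝ := max R₀ 1
  have hR₁ : ∀ ζ : ℂ, expPoly F P ζ = 0 → 0 ≤ ζ.re → ζ ∈ Metric.closedBall (0 : ℂ) R₁ := by
    intro ζ h0 hre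
    rw [mem_closedBall_zero_iff]
    by_contra! hcon
    have h1 : R₀ < ‖ζ‖ := lt_of_le_of_lt (le_max_left _ _) hcon
    have h2 : 1 < ‖ζ‖ := lt_of_le_of_lt (le_max_right _ _) hcon
    exact (hR₀ ζ hre h1.le).ne_zero (Polynomial.leadingCoeff_ne_zero.mpr hP0)
      (norm_pos_iff.mp (by linarith)) h0
  have hball : Bornology.IsBounded (Metric.closedBall (0 : ℂ) R₁) := Metric.isBounded_closedBall
  rcases le_or_gt μ 0 with hμ | hμ
  -- For μ ≤ 0 the vertex is v = 0, and the region lies in the closed right half-plane, where all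
  -- zeros lie in a fixed ball.
  · have hv0 : v = 0 := by
      by_contra hv0
      have h1 := hmax 0 h0F (Ne.symm hv0)
      obtain ⟨h2, h3⟩ := hF v hv hv0
      have h4 : ((P v).natDegree : ℝ) < (P 0).natDegree := by exact_mod_cast h3
      nlinarith
    rw [hv0, neg_zero, zero_div]
    refine squeeze_zero' (g := fun R : ℝ =>
      (zeroCount (expPoly F P) (Metric.closedBall 0 R₁) : ℝ) / R) ?_ ?_
      (tendsto_const_nhds.div_atTop tendsto_id)
    · filter_upwards [eventually_gt_atTop 0] with R hR
      positivity
    · filter_upwards [eventually_gt_atTop 0] with R hR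
      gcongr
      refine zeroCount_mono hf hne hball fun ζ hζ h0 => hR₁ ζ h0 (le_trans ?_ hζ.1)
      have : 0 ≤ Real.log (|ζ.im| + 1) := Real.log_nonneg (by linarith [abs_nonneg ζ.im])
      nlinarith
  · obtain ⟨S₁, hS₁, hlim₁⟩ := exists_tendsto_zeroCount_logStrip h0F hP0 hF hμ hv hPv hmax
      (σ := 1) (Or.inl rfl)
    obtain ⟨S₂, hS₂, hlim₂⟩ := exists_tendsto_zeroCount_logStrip h0F hP0 hF hμ hv hPv hmax
      (σ := -1) (Or.inr rfl)
    set S : ℝ := max S₁ S₂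
    have hS : 0 < S := hS₁.trans_le (le_max_left _ _)
    have hb₁ := fun T => isBounded_logStrip (σ := 1) (Or.inl rfl) μ hS.le T
    have hb₂ := fun T => isBounded_logStrip (σ := -1) (Or.inr rfl) μ hS.le T
    set G : ℝ → ℝ := fun T => (zeroCount (expPoly F P) (logStrip 1 μ S T) : ℝ) +
      zeroCount (expPoly F P) (logStrip (-1) μ S T) with hG
    have hGlim : Tendsto (fun T => G T / T) atTop (𝓝 (-v / Real.pi)) := by
      have := (hlim₁ S (le_max_left _ _)).add (hlim₂ S (le_max_right _ _))
      simp only [← add_div] at this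
      convert this using 2
      field_simp
      ring
    have hshift : Tendsto (fun R : ℝ => R - μ * Real.log (R + 1)) atTop atTop := by
      have h1 := tendsto_id.atTop_mul_pos one_pos (tendsto_sub_log_div μ)
      refine h1.congr' ?_
      filter_upwards [eventually_gt_atTop 0] with R hR
      simp only [id]
      field_simp
    -- Zeros in the right half-plane or at height at most S are bounded in number by B,
    -- independently of R, and do not affect the density.
    set Q : Set ℂ := {ζ | -μ * Real.log (|ζ.im| + 1) ≤ ζ.re ∧ ζ.re ≤ 0 ∧ |ζ.im| ≤ S}
    have hQ : Bornology.IsBounded Q := isBounded_of_log_le (μ := μ) (T := S) fun ζ hζ => hζ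
    set B : ℝ := (zeroCount (expPoly F P) (Metric.closedBall 0 R₁) : ℝ) +
      zeroCount (expPoly F P) Q with hB
    -- Strips up to height R - μ log(R + 1) fit in the disc |ζ| ≤ R, while the part of the disc
    -- outside the ball and Q lies in the strips up to height R. The two heights are asymptotically
    -- equal, so the bounds pinch.
    have hlow : Tendsto (fun R : ℝ => G (R - μ * Real.log (R + 1)) / R) atTop
        (𝓝 (-v / Real.pi)) := by
      have := (hGlim.comp hshift).mul (tendsto_sub_log_div μ)
      rw [mul_one] at this
      refine this.congr' ?_
      filter_upwards [eventually_gt_atTop 0, hshift.eventually_gt_atTop 0] with R hR hR'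
      simp only [Function.comp]
      field_simp
    have hup : Tendsto (fun R : ℝ => B / R + G R / R) atTop (𝓝 (-v / Real.pi)) := by
      simpa using (tendsto_const_nhds.div_atTop tendsto_id (a := B)).add hGlim
    refine tendsto_of_tendsto_of_tendsto_of_le_of_le' hlow hup ?_ ?_
    · filter_upwards [eventually_gt_atTop 0] with R hR
      gcongr
      simp only [hG]
      rw [← Nat.cast_add, ← zeroCount_union hf hne (hb₁ _) (hb₂ _)]
      · refine Nat.cast_le.mpr (zeroCount_mono hf hne (isBounded_logRegion μ R) ?_)
        have key : ∀ σ : ℝ, (σ = 1 ∨ σ = -1) → ∀ ζ ∈ logStrip σ μ S (R - μ * Real.log (R + 1)),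
            ζ ∈ logRegion μ R := by
          rintro σ hσ ζ ⟨h1, h2, h3, h4⟩
          have ha : |ζ.im| = σ * ζ.im := abs_eq_sign_mul hσ (by linarith)
          refine ⟨h1, (Complex.norm_le_abs_re_add_abs_im ζ).trans ?_⟩
          rw [abs_of_nonpos h2]
          have l0 : 0 ≤ μ * Real.log (R + 1) :=
            mul_nonneg hμ.le (Real.log_nonneg (by linarith))
          have l1 : μ * Real.log (|ζ.im| + 1) ≤ μ * Real.log (R + 1) :=
            mul_le_mul_of_nonneg_left (Real.log_le_log (by positivity) (by linarith)) hμ.le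
          linarith
        rintro ζ (hζ | hζ) -
        · exact key 1 (Or.inl rfl) ζ hζ
        · exact key (-1) (Or.inr rfl) ζ hζ
      · refine Set.disjoint_left.mpr fun ζ h h' => ?_
        have h1 := h.2.2.1
        have h2 := h'.2.2.1
        linarith
    · filter_upwards [eventually_gt_atTop 0] with R hR
      rw [← add_div]
      gcongr
      have hbU := ((hball.union hQ).union ((hb₁ R).union (hb₂ R)))
      have h1 := zeroCount_mono hf hne (S := logRegion μ R) hbU (fun ζ hζ h0 => by
        rcases le_or_gt 0 ζ.re with hre | hre
        · exact Or.inl (Or.inl (hR₁ ζ h0 hre))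
        · rcases le_or_gt |ζ.im| S with him | him
          · exact Or.inl (Or.inr ⟨hζ.1, hre.le, him⟩)
          · have hn := (Complex.abs_im_le_norm ζ).trans hζ.2
            rcases abs_cases ζ.im with h | h
            · exact Or.inr (Or.inl ⟨hζ.1, hre.le, by linarith, by linarith⟩)
            · exact Or.inr (Or.inr ⟨hζ.1, hre.le, by linarith, by linarith⟩))
      have h2 := zeroCount_union_le hf hne (hball.union hQ) ((hb₁ R).union (hb₂ R))
      have h3 := zeroCount_union_le hf hne hball hQ
      have h4 := zeroCount_union_le hf hne (hb₁ R) (hb₂ R)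
      simp only [hB, hG]
      exact_mod_cast h1.trans (h2.trans (add_le_add h3 h4))

/-! ### Concave polygons and their supporting lines -/

/-- The upper convex hull of the graph of a function on a finite set of reals. -/
theorem exists_concave_polygon (d : ℝ → ℝ) : ∀ (k : ℕ) (F : Finset ℝ), F.card = k → F.Nonempty →
    ∃ (M : ℕ) (v : Fin (M + 1) → ℝ), StrictMono v ∧ (∀ i, v i ∈ F) ∧ (∀ b ∈ F, v 0 ≤ b) ∧
      (∀ b ∈ F, b ≤ v (Fin.last M)) ∧
      (StrictAnti fun n : Fin M =>
        (d (v n.succ) - d (v n.castSucc)) / (v n.succ - v n.castSucc)) ∧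
      ∀ n : Fin M, ∀ b ∈ F, v n.castSucc ≤ b → b ≤ v n.succ →
        d b ≤ d (v n.castSucc) +
          (d (v n.succ) - d (v n.castSucc)) / (v n.succ - v n.castSucc) * (b - v n.castSucc) := by
  intro k
  induction k using Nat.strong_induction_on with
  | _ k ih =>
  intro F hk hF
  set m := F.min' hF with hm
  have hmF : m ∈ F := F.min'_mem hF
  have hmin : ∀ b ∈ F, m ≤ b := fun b hb => F.min'_le b hb
  rcases (F.erase m).eq_empty_or_nonempty with hE | hE
  · have hall : ∀ b ∈ F, b = m := fun b hb => by
      by_contra hbm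
      have : b ∈ F.erase m := Finset.mem_erase.mpr ⟨hbm, hb⟩
      simp [hE] at this
    refine ⟨0, fun _ => m, fun i j h => by omega, fun _ => hmF, hmin,
      fun b hb => (hall b hb).le, fun n => n.elim0, fun n => n.elim0⟩
  -- Gift wrapping: from the leftmost point the edge of greatest slope is taken, with ties broken by
  -- the largest abscissa, and the construction continues on the points from b on.
  · obtain ⟨b, hb, hbmax⟩ := Finset.exists_max_image (F.erase m)
      (fun c => toLex ((d c - d m) / (c - m), c)) hE
    obtain ⟨hbm, hbF⟩ := Finset.mem_erase.mp hb
    have hmb : m < b := lt_of_le_of_ne (hmin b hbF) (Ne.symm hbm)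
    set s := (d b - d m) / (b - m) with hs
    have hsb : d b = d m + s * (b - m) := by
      rw [hs, div_mul_cancel₀ _ (sub_ne_zero.mpr hbm)]
      ring
    have hle : ∀ c ∈ F, d c ≤ d m + s * (c - m) := by
      intro c hc
      rcases eq_or_ne c m with rfl | hcm
      · simp
      have h1 := hbmax c (Finset.mem_erase.mpr ⟨hcm, hc⟩)
      have hcm' : m < c := lt_of_le_of_ne (hmin c hc) (Ne.symm hcm)
      rw [Prod.Lex.toLex_le_toLex] at h1
      have h2 : (d c - d m) / (c - m) ≤ s := by
        rcases h1 with h | h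
        · exact h.le
        · exact h.1.le
      rw [div_le_iff₀ (by linarith)] at h2
      linarith
    -- The tie-breaking makes the inequality strict beyond b. This makes the next slope strictly
    -- smaller, so that the segments are maximal.
    have hlt : ∀ c ∈ F, b < c → d c < d m + s * (c - m) := by
      intro c hc hbc
      have h1 := hbmax c (Finset.mem_erase.mpr ⟨(hmb.trans hbc).ne', hc⟩)
      rw [Prod.Lex.toLex_le_toLex] at h1
      have h2 : (d c - d m) / (c - m) < s := by
        rcases h1 with h | h
        · exact h
        · exact absurd h.2 (not_le.mpr hbc)
      rw [div_lt_iff₀ (by linarith)] at h2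
      linarith
    set F' := F.filter (b ≤ ·) with hF'
    have hF'm : ∀ c, c ∈ F' ↔ c ∈ F ∧ b ≤ c := fun c => Finset.mem_filter
    have hcard : F'.card < k := by
      rw [← hk]
      refine Finset.card_lt_card ((Finset.ssubset_iff_of_subset (Finset.filter_subset _ _)).mpr
        ⟨m, hmF, fun h => ?_⟩)
      exact not_le.mpr hmb ((hF'm m).mp h).2
    have hbF' : b ∈ F' := (hF'm b).mpr ⟨hbF, le_rfl⟩
    obtain ⟨M, v, hv1, hv2, hv3, hv4, hv5, hv6⟩ := ih _ hcard F' rfl ⟨b, hbF'⟩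
    have hv0 : v 0 = b := le_antisymm (hv3 b hbF') ((hF'm _).mp (hv2 0)).2
    have hfirst : ∀ n : Fin M, (d (v n.succ) - d (v n.castSucc)) / (v n.succ - v n.castSucc) < s := by
      intro n
      have h0 : ∀ n : Fin M, n.castSucc = 0 →
          (d (v n.succ) - d (v n.castSucc)) / (v n.succ - v n.castSucc) < s := by
        intro n hn
        have h1 : v n.castSucc < v n.succ := hv1 n.castSucc_lt_succ
        rw [hn, hv0] at h1 ⊢
        rw [div_lt_iff₀ (by linarith)]
        have := hlt _ ((hF'm _).mp (hv2 n.succ)).1 h1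
        linarith
      cases M with
      | zero => exact n.elim0
      | succ M => exact (hv5.antitone (Fin.zero_le n)).trans_lt (h0 0 rfl)
    refine ⟨M + 1, Fin.cons m v, ?_, ?_, ?_, ?_, ?_, ?_⟩
    · rw [Fin.strictMono_iff_lt_succ]
      intro i
      refine Fin.cases ?_ (fun i => ?_) i
      · simpa [hv0] using hmb
      · simpa [← Fin.succ_castSucc] using hv1 i.castSucc_lt_succ
    · intro i
      refine Fin.cases ?_ (fun i => ?_) i
      · simpa using hmF
      · simpa using ((hF'm _).mp (hv2 i)).1
    · simpa using hmin
    · intro c hc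
      rw [← Fin.succ_last, Fin.cons_succ]
      rcases le_or_gt b c with h | h
      · exact hv4 c ((hF'm c).mpr ⟨hc, h⟩)
      · exact h.le.trans (hv4 b hbF')
    · intro i j hij
      induction j using Fin.cases with
      | zero => exact absurd hij (Fin.not_lt_zero i)
      | succ j =>
        induction i using Fin.cases with
        | zero => simpa [← Fin.succ_castSucc, hv0] using hfirst j
        | succ i => simpa [← Fin.succ_castSucc] using hv5 (Fin.succ_lt_succ_iff.mp hij)
    · intro n c hc
      refine Fin.cases ?_ (fun n => ?_) n
      · intro _ _
        simpa [hv0] using hle c hc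
      · simp only [← Fin.succ_castSucc, Fin.cons_succ]
        intro h1 h2
        refine hv6 n c ((hF'm c).mpr ⟨hc, ?_⟩) h1 h2
        exact ((hF'm _).mp (hv2 _)).2.trans h1

/-- A linear functional that is parallel to no segment of a concave polygon is maximal at exactly
one vertex. -/
theorem exists_vertex_max {d : ℝ → ℝ} {F : Finset ℝ} {M : ℕ} {v : Fin (M + 1) → ℝ}
    {s : Fin M → ℝ} (hs : ∀ n, s n * (v n.succ - v n.castSucc) = d (v n.succ) - d (v n.castSucc))
    (hv1 : StrictMono v) (hv2 : ∀ i, v i ∈ F) (hv3 : ∀ b ∈ F, v 0 ≤ b)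
    (hv4 : ∀ b ∈ F, b ≤ v (Fin.last M)) (hv5 : StrictAnti s)
    (hv6 : ∀ n : Fin M, ∀ b ∈ F, v n.castSucc ≤ b → b ≤ v n.succ →
        d b ≤ d (v n.castSucc) + s n * (b - v n.castSucc))
    {μ : ℝ} (hμ : ∀ n, s n ≠ μ) :
    ∃ j, (∀ n : Fin M, n.castSucc < j → μ < s n) ∧ (∀ n : Fin M, j ≤ n.castSucc → s n < μ) ∧
      ∀ b ∈ F, b ≠ v j → d b - μ * b < d (v j) - μ * v j := by
  set h : ℝ → ℝ := fun b => d b - μ * b with hh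
  have hstep : ∀ n : Fin M, h (v n.succ) - h (v n.castSucc) =
      (s n - μ) * (v n.succ - v n.castSucc) := fun n => by
    rw [sub_mul, hs]
    simp only [hh]
    ring
  have hpos : ∀ n : Fin M, 0 < v n.succ - v n.castSucc := fun n =>
    sub_pos.mpr (hv1 n.castSucc_lt_succ)
  -- A maximizer strictly inside a segment would lie on or below the chord. The chord is not level
  -- for h because its slope differs from μ, so one of its endpoints would be strictly higher.
  have hvertex : ∀ b ∈ F, (∀ c ∈ F, h c ≤ h b) → ∃ j, b = v j := by
    intro b hb hmax
    obtain ⟨i, hi, himax⟩ := Finset.exists_max_image (Finset.univ.filter fun i => v i ≤ b) id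
      ⟨0, by simpa using hv3 b hb⟩
    have hib : v i ≤ b := (Finset.mem_filter.mp hi).2
    induction i using Fin.lastCases with
    | last => exact ⟨Fin.last M, le_antisymm (hv4 b hb) hib⟩
    | cast n =>
      have hbn : b < v n.succ := by
        by_contra! hcon
        have := himax n.succ (by simpa using hcon)
        exact absurd this (not_le.mpr n.castSucc_lt_succ)
      refine ⟨n.castSucc, ?_⟩
      by_contra hne
      have hlt : v n.castSucc < b := lt_of_le_of_ne hib (Ne.symm hne)
      have h1 := hv6 n b hb hib hbn.le
      have h2 := hmax _ (hv2 n.castSucc)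
      have h3 := hmax _ (hv2 n.succ)
      have h4 := hstep n
      simp only [hh] at h2 h3 h4
      rcases lt_or_gt_of_ne (hμ n) with hlt' | hlt'
      · nlinarith [mul_pos (sub_pos.mpr hlt') (sub_pos.mpr hlt)]
      · nlinarith [mul_pos (sub_pos.mpr hlt') (sub_pos.mpr hbn)]
  have hleft : ∀ j, (∀ c ∈ F, h c ≤ h (v j)) → ∀ n : Fin M, n.castSucc < j → μ < s n := by
    intro j hmax n hn
    obtain ⟨k, rfl⟩ := Fin.exists_succ_eq.mpr (Fin.ne_zero_of_lt hn)
    have h1 : 0 ≤ (s k - μ) * (v k.succ - v k.castSucc) := by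
      rw [← hstep]
      linarith [hmax _ (hv2 k.castSucc)]
    have h2 : 0 ≤ s k - μ := nonneg_of_mul_nonneg_left h1 (hpos k)
    have h3 : μ < s k := lt_of_le_of_ne (by linarith) (Ne.symm (hμ k))
    exact h3.trans_le (hv5.antitone (Fin.castSucc_lt_succ_iff.mp hn))
  have hright : ∀ j, (∀ c ∈ F, h c ≤ h (v j)) → ∀ n : Fin M, j ≤ n.castSucc → s n < μ := by
    intro j hmax n hn
    obtain ⟨k, rfl⟩ := Fin.exists_castSucc_eq.mpr (hn.trans_lt n.castSucc_lt_last).ne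
    have h1 : (s k - μ) * (v k.succ - v k.castSucc) ≤ 0 := by
      rw [← hstep]
      linarith [hmax _ (hv2 k.succ)]
    have h2 : s k - μ ≤ 0 := nonpos_of_mul_nonpos_left h1 (hpos k)
    have h3 : s k < μ := lt_of_le_of_ne (by linarith) (hμ k)
    exact (hv5.antitone (Fin.castSucc_le_castSucc_iff.mp hn)).trans_lt h3
  -- Between two maximal vertices i < j, the segment starting at i would have slope both greater and
  -- less than μ.
  have huniq : ∀ i j, (∀ c ∈ F, h c ≤ h (v i)) → (∀ c ∈ F, h c ≤ h (v j)) → ¬ i < j := by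
    intro i j hi hj hij
    obtain ⟨k, rfl⟩ := Fin.exists_castSucc_eq.mpr (hij.trans_le (Fin.le_last j)).ne
    exact lt_asymm (hleft j hj k hij) (hright _ hi k le_rfl)
  obtain ⟨b, hb, hbmax⟩ := Finset.exists_max_image F h ⟨v 0, hv2 0⟩
  obtain ⟨j, rfl⟩ := hvertex b hb hbmax
  refine ⟨j, hleft j hbmax, hright j hbmax, fun c hc hcj => ?_⟩
  refine lt_of_le_of_ne (hbmax c hc) fun heq => ?_
  have hcmax : ∀ c' ∈ F, h c' ≤ h c := fun c' hc' => (hbmax c' hc').trans_eq heq.symm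
  obtain ⟨i, rfl⟩ := hvertex c hc hcmax
  rcases lt_trichotomy i j with hij | hij | hij
  · exact huniq i j hcmax hbmax hij
  · exact hcj (by rw [hij])
  · exact huniq j i hbmax hcmax hij

/-! ### Frequencies and degrees of the characteristic determinant -/

namespace PointInteraction

variable {N : ℕ} (a : Fin N → ℂ) {y : Fin N → EuclideanSpace ℝ (Fin 3)}

theorem permFreq_nonpos (y : Fin N → EuclideanSpace ℝ (Fin 3)) (σ : Equiv.Perm (Fin N)) :
    permFreq y σ ≤ 0 :=
  neg_nonpos.mpr (Finset.sum_nonneg fun _ _ => norm_nonneg _)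

theorem permFreq_one (y : Fin N → EuclideanSpace ℝ (Fin 3)) : permFreq y 1 = 0 := by
  simp [permFreq]

theorem permFreq_eq_zero_iff (hy : Function.Injective y) (σ : Equiv.Perm (Fin N)) :
    permFreq y σ = 0 ↔ σ = 1 := by
  refine ⟨fun h => ?_, fun h => h ▸ permFreq_one y⟩
  rw [permFreq, neg_eq_zero, Finset.sum_eq_zero_iff_of_nonneg fun _ _ => norm_nonneg _] at h
  ext1 j
  by_contra hj
  have := h j (by simpa using hj)
  rw [norm_eq_zero, sub_eq_zero] at this
  exact hj (hy this).symm

/-- The polynomial factor that the fixed points contribute. -/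
theorem natDegree_leadingCoeff_prod_fixed (s : Finset (Fin N)) :
    (∏ j ∈ s, (-Polynomial.X - Polynomial.C (4 * (Real.pi : ℂ) * a j))).natDegree = s.card ∧
    (∏ j ∈ s, (-Polynomial.X - Polynomial.C (4 * (Real.pi : ℂ) * a j))).leadingCoeff =
      (-1) ^ s.card := by
  have h : ∀ c : ℂ, -Polynomial.X - Polynomial.C c =
      Polynomial.C (-1) * Polynomial.X + Polynomial.C (-c) := fun c => by simp; ring
  have h1 : ∀ c : ℂ, (-Polynomial.X - Polynomial.C c).natDegree = 1 := fun c => by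
    rw [h]
    exact Polynomial.natDegree_linear (by norm_num)
  have h2 : ∀ c : ℂ, (-Polynomial.X - Polynomial.C c).leadingCoeff = -1 := fun c => by
    rw [h]
    exact Polynomial.leadingCoeff_linear (by norm_num)
  constructor
  · rw [Polynomial.natDegree_prod]
    · simp only [h1, Finset.sum_const, smul_eq_mul, mul_one]
    · intro j _ h0
      have := h1 (4 * (Real.pi : ℂ) * a j)
      rw [h0, Polynomial.natDegree_zero] at this
      exact zero_ne_one this
  · rw [Polynomial.leadingCoeff_prod]
    simp only [h2, Finset.prod_const]

theorem card_fixed_add_card_support (σ : Equiv.Perm (Fin N)) :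
    (Finset.univ.filter fun j => σ j = j).card + σ.support.card = N := by
  have := Finset.card_filter_add_card_filter_not (s := (Finset.univ : Finset (Fin N)))
    (fun j => σ j = j)
  rw [Finset.card_univ, Fintype.card_fin] at this
  exact this

theorem natDegree_permPoly_le (y : Fin N → EuclideanSpace ℝ (Fin 3)) (σ : Equiv.Perm (Fin N)) :
    (permPoly a y σ).natDegree + σ.support.card ≤ N := by
  have h1 := Polynomial.natDegree_C_mul_le
    (((Equiv.Perm.sign σ : ℤ) : ℂ) * ∏ j with σ j ≠ j, ((‖y j - y (σ j)‖ : ℂ))⁻¹)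
    (∏ j with σ j = j, (-Polynomial.X - Polynomial.C (4 * (Real.pi : ℂ) * a j)))
  rw [(natDegree_leadingCoeff_prod_fixed a _).1] at h1
  have h2 := card_fixed_add_card_support σ
  unfold permPoly
  omega

/-- The points are distinct, so only the identity has frequency 0, and P_0 is the product of all N
linear factors. -/
theorem freqPoly_zero (hy : Function.Injective y) :
    (freqPoly a y 0).natDegree = N ∧ freqPoly a y 0 ≠ 0 := by
  have h1 : freqPoly a y 0 =
      ∏ j ∈ (Finset.univ : Finset (Fin N)),
        (-Polynomial.X - Polynomial.C (4 * (Real.pi : ℂ) * a j)) := by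
    unfold freqPoly
    simp_rw [permFreq_eq_zero_iff hy]
    rw [Finset.filter_eq' Finset.univ, if_pos (Finset.mem_univ _), Finset.sum_singleton]
    simp [permPoly]
  obtain ⟨h2, h3⟩ := natDegree_leadingCoeff_prod_fixed a (Finset.univ : Finset (Fin N))
  rw [← h1] at h2 h3
  refine ⟨by simpa using h2, fun h0 => ?_⟩
  rw [h0, Polynomial.leadingCoeff_zero] at h3
  exact pow_ne_zero _ (by norm_num) h3.symm

/-- A permutation other than the identity moves at least two points, so it contributes at most N - 2
linear factors. -/
theorem natDegree_freqPoly_lt (hN : 2 ≤ N) (y : Fin N → EuclideanSpace ℝ (Fin 3)) {b : ℝ}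
    (hb : b ≠ 0) : (freqPoly a y b).natDegree < N := by
  refine lt_of_le_of_lt (Polynomial.natDegree_sum_le_of_forall_le (n := N - 1) _ _ fun σ hσ => ?_)
    (by omega)
  have h1 : σ ≠ 1 := by
    rintro rfl
    exact hb ((Finset.mem_filter.mp hσ).2.symm.trans (permFreq_one y))
  have h2 := natDegree_permPoly_le a y σ
  have h3 := Equiv.Perm.two_le_card_support_of_ne_one h1
  omega

/-- Among permutations other than the identity only transpositions reach degree N - 2, and they all
have sign -1. The coefficients therefore share one phase and cannot cancel each other. -/
theorem coeff_permPoly (hy : Function.Injective y) {σ : Equiv.Perm (Fin N)} (hσ : σ ≠ 1) :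
    ∃ r : ℝ, 0 ≤ r ∧ (σ.IsSwap → 0 < r) ∧
      (permPoly a y σ).coeff (N - 2) = -(-1) ^ (N - 2) * (r : ℂ) := by
  by_cases hsw : σ.IsSwap
  · set r : ℝ := ∏ j with σ j ≠ j, ‖y j - y (σ j)‖⁻¹ with hr
    have hr0 : 0 < r := Finset.prod_pos fun j hj => inv_pos.mpr (norm_pos_iff.mpr fun h => by
      rw [sub_eq_zero] at h
      exact (Finset.mem_filter.mp hj).2 (hy h).symm)
    refine ⟨r, hr0.le, fun _ => hr0, ?_⟩
    have h1 := card_fixed_add_card_support σ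
    rw [Equiv.Perm.card_support_eq_two.mpr hsw] at h1
    obtain ⟨h2, h3⟩ := natDegree_leadingCoeff_prod_fixed a (Finset.univ.filter fun j => σ j = j)
    rw [Polynomial.leadingCoeff, h2, show (Finset.univ.filter fun j => σ j = j).card = N - 2 by
      omega] at h3
    rw [permPoly, Polynomial.coeff_C_mul, h3, hsw.sign_eq, hr]
    push_cast
    ring
  · refine ⟨0, le_rfl, fun h => absurd h hsw, ?_⟩
    rw [Complex.ofReal_zero, mul_zero]
    refine Polynomial.coeff_eq_zero_of_natDegree_lt ?_
    have h2 := natDegree_permPoly_le a y σ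
    have h3 := Equiv.Perm.two_le_card_support_of_ne_one hσ
    have h4 : σ.support.card ≠ 2 := fun h => hsw (Equiv.Perm.card_support_eq_two.mp h)
    omega

/-- Several permutations may share the frequency of a transposition, but their coefficients of
degree N - 2 are nonnegative multiples of one nonzero number, with a positive multiple from the
transposition itself. -/
theorem exists_frequency_ne_zero (hN : 2 ≤ N) (hy : Function.Injective y) :
    ∃ b ∈ frequencies a y, b ≠ 0 := by
  set τ : Equiv.Perm (Fin N) := Equiv.swap ⟨0, by omega⟩ ⟨1, by omega⟩
  have hne : (⟨0, by omega⟩ : Fin N) ≠ ⟨1, by omega⟩ := by simp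
  have hτ : τ.IsSwap := ⟨_, _, hne, rfl⟩
  have hτ1 : τ ≠ 1 := by
    intro h
    have := Equiv.Perm.card_support_eq_two.mpr hτ
    simp [h] at this
  have hb : permFreq y τ ≠ 0 := fun h => hτ1 ((permFreq_eq_zero_iff hy τ).mp h)
  refine ⟨permFreq y τ, fun h0 => ?_, hb⟩
  have hσ1 : ∀ σ ∈ Finset.univ.filter (fun σ => permFreq y σ = permFreq y τ), σ ≠ 1 := by
    rintro σ hσ rfl
    exact hb ((Finset.mem_filter.mp hσ).2.symm.trans (permFreq_one y))
  have hc := congrArg (fun p : Polynomial ℂ => p.coeff (N - 2)) h0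
  simp only [freqPoly, Polynomial.finsetSum_coeff, Polynomial.coeff_zero] at hc
  have hex : ∀ σ : Equiv.Perm (Fin N), ∃ r : ℝ, σ ≠ 1 → 0 ≤ r ∧ (σ.IsSwap → 0 < r) ∧
      (permPoly a y σ).coeff (N - 2) = -(-1) ^ (N - 2) * (r : ℂ) := fun σ => by
    by_cases h : σ = 1
    · exact ⟨0, fun h' => absurd h h'⟩
    · obtain ⟨r, hr⟩ := coeff_permPoly a hy h
      exact ⟨r, fun _ => hr⟩
  choose r hr using hex
  rw [Finset.sum_congr rfl fun σ hσ => (hr σ (hσ1 σ hσ)).2.2, ← Finset.mul_sum] at hc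
  have hsum := (mul_eq_zero.mp hc).resolve_left (neg_ne_zero.mpr (pow_ne_zero _ (by norm_num)))
  rw [← Complex.ofReal_sum, Complex.ofReal_eq_zero] at hsum
  have hpos : 0 < ∑ σ with permFreq y σ = permFreq y τ, r σ :=
    Finset.sum_pos' (fun σ hσ => (hr σ (hσ1 σ hσ)).1) ⟨τ, by simp, (hr τ hτ1).2.1 hτ⟩
  exact hpos.ne' hsum

theorem freqPoly_eq_zero_of_forall (y : Fin N → EuclideanSpace ℝ (Fin 3)) {b : ℝ}
    (h : ∀ σ, permFreq y σ ≠ b) : freqPoly a y b = 0 :=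
  Finset.sum_eq_zero fun σ hσ => absurd (Finset.mem_filter.mp hσ).2 (h σ)

theorem exists_permFreq_eq {b : ℝ} (hb : b ∈ frequencies a y) : ∃ σ, permFreq y σ = b := by
  by_contra! h
  exact hb (freqPoly_eq_zero_of_forall a y h)

theorem finite_frequencies (y : Fin N → EuclideanSpace ℝ (Fin 3)) : (frequencies a y).Finite :=
  (Set.finite_range (permFreq y)).subset fun _ hb => exists_permFreq_eq a hb

theorem modDet_eq_expPoly (hy : Function.Injective y) :
    modDet a y = expPoly (finite_frequencies a y).toFinset (freqPoly a y) := by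
  ext ζ
  rw [modDet_eq_canonical a y hy, expPoly]
  refine finsum_eq_sum_of_support_subset _ fun b hb => ?_
  simp only [Set.Finite.coe_toFinset]
  intro h0
  apply hb
  simp [h0]

theorem zero_mem_frequencies (hy : Function.Injective y) : (0 : ℝ) ∈ frequencies a y :=
  (freqPoly_zero a hy).2

theorem frequencies_nonpos {b : ℝ} (hb : b ∈ frequencies a y) : b ≤ 0 := by
  obtain ⟨σ, rfl⟩ := exists_permFreq_eq a hb
  exact permFreq_nonpos y σ

theorem multiplicity_eq (y : Fin N → EuclideanSpace ℝ (Fin 3)) (ζ : ℂ) :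
    multiplicity a y (Complex.I * ζ) = analyticOrderNatAt (modDet a y) ζ := by
  have hc : (-4 * (Real.pi : ℂ)) ^ N ≠ 0 :=
    pow_ne_zero _ (mul_ne_zero (by norm_num) (by exact_mod_cast Real.pi_ne_zero))
  have hg : AnalyticAt ℂ (fun ζ : ℂ => Complex.I * ζ) ζ := by fun_prop
  have hg' : deriv (fun ζ : ℂ => Complex.I * ζ) ζ ≠ 0 := by
    rw [deriv_const_mul _ differentiableAt_fun_id]
    simp
  have h1 := analyticOrderAt_comp_of_deriv_ne_zero (f := charDet a y) hg hg'
  have h2 : modDet a y = (fun _ => (-4 * (Real.pi : ℂ)) ^ N) *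
      (charDet a y ∘ fun ζ : ℂ => Complex.I * ζ) := rfl
  have h3 : analyticOrderAt (modDet a y) ζ =
      analyticOrderAt (charDet a y ∘ fun ζ : ℂ => Complex.I * ζ) ζ := by
    -- Where the composition is not analytic, neither is `modDet`, and both orders take the default
    -- value 0.
    by_cases han : AnalyticAt ℂ (charDet a y ∘ fun ζ : ℂ => Complex.I * ζ) ζ
    · rw [h2, analyticOrderAt_mul analyticAt_const han,
        show analyticOrderAt (fun _ : ℂ => (-4 * (Real.pi : ℂ)) ^ N) ζ = 0 from
          analyticOrderAt_eq_zero.mpr (Or.inr hc), zero_add]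
    · rw [analyticOrderAt_of_not_analyticAt han, analyticOrderAt_of_not_analyticAt]
      intro h
      apply han
      have h4 : (charDet a y ∘ fun ζ : ℂ => Complex.I * ζ) =
          (fun _ => ((-4 * (Real.pi : ℂ)) ^ N)⁻¹) * modDet a y := by
        ext w
        simp only [h2, Pi.mul_apply]
        rw [inv_mul_cancel_left₀ hc]
      rw [h4]
      exact analyticAt_const.mul h
  rw [multiplicity, analyticOrderNatAt, analyticOrderNatAt, h3, h1]

theorem dominant_zero_frequency (hN : 2 ≤ N) (hy : Function.Injective y) :
    ∀ b ∈ (finite_frequencies a y).toFinset, b ≠ 0 →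
      b < 0 ∧ (freqPoly a y b).natDegree < (freqPoly a y 0).natDegree := by
  intro b hb hb0
  rw [Set.Finite.mem_toFinset] at hb
  refine ⟨lt_of_le_of_ne (frequencies_nonpos a hb) hb0, ?_⟩
  rw [(freqPoly_zero a hy).1]
  exact natDegree_freqPoly_lt a hN y hb0

theorem modDet_ne_zero (hN : 2 ≤ N) (hy : Function.Injective y) : modDet a y ≠ 0 := by
  rw [modDet_eq_expPoly a hy]
  exact expPoly_ne_zero_fun ((Set.Finite.mem_toFinset _).mpr (zero_mem_frequencies a hy))
    (freqPoly_zero a hy).2 (dominant_zero_frequency a hN hy)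

/-- The rotation ζ ↦ iζ preserves the modulus, turns Re ζ into Im k and Im ζ into -Re k, and
preserves multiplicities. -/
theorem logCount_eq_zeroCount (hN : 2 ≤ N) (hy : Function.Injective y) (μ R : ℝ) :
    logCount a y μ R = zeroCount (modDet a y) (logRegion μ R) := by
  have hd : Differentiable ℂ (modDet a y) := by
    rw [modDet_eq_expPoly a hy]
    exact differentiable_expPoly _ _
  have hne := modDet_ne_zero a hN hy
  have hc : (-4 * (Real.pi : ℂ)) ^ N ≠ 0 :=
    pow_ne_zero _ (mul_ne_zero (by norm_num) (by exact_mod_cast Real.pi_ne_zero))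
  rw [zeroCount_congr hd hne (T := {ζ | ζ ∈ logRegion μ R ∧ modDet a y ζ = 0})
    fun ζ h0 => by simp [h0]]
  symm
  refine finsum_mem_eq_of_bijOn (fun ζ : ℂ => Complex.I * ζ) ⟨?_, ?_, ?_⟩
    fun ζ _ => (multiplicity_eq a y ζ).symm
  · rintro ζ ⟨⟨h1, h2⟩, h3⟩
    have h3' : charDet a y (Complex.I * ζ) = 0 := (mul_eq_zero.mp h3).resolve_left hc
    exact ⟨h3', by simpa using h1, by simpa using h2⟩
  · intro z _ w _ h
    exact mul_left_cancel₀ Complex.I_ne_zero h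
  · rintro k ⟨h1, h2, h3⟩
    have hk : Complex.I * (-Complex.I * k) = k := by
      rw [← mul_assoc, mul_neg, Complex.I_mul_I, neg_neg, one_mul]
    refine ⟨-Complex.I * k, ⟨⟨by simpa using h2, by simpa using h3⟩, ?_⟩, hk⟩
    rw [modDet, hk]
    exact mul_eq_zero_of_right _ h1

end PointInteraction

/-! ### The density as a step function -/

namespace PointInteraction

variable {N : ℕ} {a : Fin N → ℂ} {y : Fin N → EuclideanSpace ℝ (Fin 3)}
  {M : ℕ} {v : Fin (M + 1) → ℝ}

theorem exists_isDistributionDiagram (a : Fin N → ℂ) (hy : Function.Injective y) :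
    ∃ (M : ℕ) (v : Fin (M + 1) → ℝ), IsDistributionDiagram a y M v := by
  have hF := finite_frequencies a y
  obtain ⟨M, v, h1, h2, h3, h4, h5, h6⟩ := exists_concave_polygon
    (fun b => ((freqPoly a y b).natDegree : ℝ)) _ hF.toFinset rfl
    ⟨0, hF.mem_toFinset.mpr (zero_mem_frequencies a hy)⟩
  simp only [Set.Finite.mem_toFinset] at h2 h3 h4 h6
  exact ⟨M, v, h1, h2, h3, h4, h5, h6⟩

theorem IsDistributionDiagram.last_eq_zero (hv : IsDistributionDiagram a y M v)
    (hy : Function.Injective y) : v (Fin.last M) = 0 :=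
  le_antisymm (frequencies_nonpos a (hv.mem _)) (hv.right _ (zero_mem_frequencies a hy))

theorem IsDistributionDiagram.one_le (hv : IsDistributionDiagram a y M v) (hN : 2 ≤ N)
    (hy : Function.Injective y) : 1 ≤ M := by
  by_contra! hM
  obtain rfl : M = 0 := by omega
  obtain ⟨b, hb, hb0⟩ := exists_frequency_ne_zero a hN hy
  have h1 := hv.left b hb
  have h2 := hv.last_eq_zero hy
  have h3 := frequencies_nonpos a hb
  have h4 : v 0 = 0 := h2
  exact hb0 (by linarith)

theorem IsDistributionDiagram.width_pos (hv : IsDistributionDiagram a y M v) (n : Fin M) :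
    0 < v n.succ - v n.castSucc :=
  sub_pos.mpr (hv.strictMono n.castSucc_lt_succ)

theorem IsDistributionDiagram.mu_mul_width (hv : IsDistributionDiagram a y M v) (n : Fin M) :
    mu a y v n * (v n.succ - v n.castSucc) =
      ((freqPoly a y (v n.succ)).natDegree : ℝ) - (freqPoly a y (v n.castSucc)).natDegree :=
  div_mul_cancel₀ _ (hv.width_pos n).ne'

/-- The last segment ends at 0, where the degree N is strictly largest, so its slope is positive. By
concavity all earlier slopes are at least as large. -/
theorem IsDistributionDiagram.mu_pos (hv : IsDistributionDiagram a y M v) (hN : 2 ≤ N)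
    (hy : Function.Injective y) (n : Fin M) : 0 < mu a y v n := by
  obtain ⟨k, hk⟩ : ∃ k : Fin M, k.succ = Fin.last M :=
    Fin.exists_succ_eq.mpr (Fin.ne_zero_of_lt (n.castSucc_lt_last))
  have h1 : v k.succ = 0 := by rw [hk, hv.last_eq_zero hy]
  have h2 : v k.castSucc ≠ 0 := by
    have := hv.width_pos k
    rw [h1] at this
    linarith
  have h3 : 0 < mu a y v k := by
    refine div_pos (sub_pos.mpr ?_) (hv.width_pos k)
    rw [h1, (freqPoly_zero a hy).1]
    exact_mod_cast natDegree_freqPoly_lt a hN y h2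
  refine h3.trans_le (hv.concave.antitone ?_)
  rw [← Fin.succ_le_succ_iff, hk]
  exact Fin.le_last _

/-- The density away from the slopes of the distribution diagram. -/
theorem IsDistributionDiagram.exists_tendsto (hv : IsDistributionDiagram a y M v) (hN : 2 ≤ N)
    (hy : Function.Injective y) {μ : ℝ} (hμ : μ ∉ Set.range (mu a y v)) :
    ∃ j : Fin (M + 1), (∀ n : Fin M, n.castSucc < j → μ < mu a y v n) ∧
      (∀ n : Fin M, j ≤ n.castSucc → mu a y v n < μ) ∧
      Tendsto (fun R : ℝ => (logCount a y μ R : ℝ) / R) atTop (𝓝 (-v j / Real.pi)) ∧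
      logDensity a y μ = -v j / Real.pi := by
  have hF := finite_frequencies a y
  have hmem : ∀ {b}, b ∈ hF.toFinset ↔ b ∈ frequencies a y := hF.mem_toFinset
  obtain ⟨j, h1, h2, h3⟩ := exists_vertex_max (d := fun b => ((freqPoly a y b).natDegree : ℝ))
    (F := hF.toFinset) hv.mu_mul_width hv.strictMono (fun i => hmem.mpr (hv.mem i))
    (fun b hb => hv.left b (hmem.mp hb)) (fun b hb => hv.right b (hmem.mp hb)) hv.concave
    (fun n b hb => hv.above n b (hmem.mp hb)) (μ := μ) (fun n h => hμ ⟨n, h⟩)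
  have h4 := tendsto_zeroCount_logRegion (hmem.mpr (zero_mem_frequencies a hy))
    (freqPoly_zero a hy).2 (dominant_zero_frequency a hN hy) (hmem.mpr (hv.mem j)) (hv.mem j) h3
  rw [← modDet_eq_expPoly a hy] at h4
  simp only [← logCount_eq_zeroCount a hN hy] at h4
  exact ⟨j, h1, h2, h4, h4.limsup_eq⟩

theorem IsDistributionDiagram.monotone_logDensity (hv : IsDistributionDiagram a y M v) (hN : 2 ≤ N)
    (hy : Function.Injective y) : Monotone (logDensity a y) := by
  have hd : Differentiable ℂ (modDet a y) := by
    rw [modDet_eq_expPoly a hy]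
    exact differentiable_expPoly _ _
  have hmono : ∀ s t : ℝ, s ≤ t → ∀ᶠ R : ℝ in atTop,
      (logCount a y s R : ℝ) / R ≤ (logCount a y t R : ℝ) / R := by
    intro s t hst
    filter_upwards [eventually_gt_atTop 0] with R hR
    gcongr
    rw [logCount_eq_zeroCount a hN hy, logCount_eq_zeroCount a hN hy]
    refine zeroCount_mono hd (modDet_ne_zero a hN hy) (isBounded_logRegion t R) fun ζ hζ _ =>
      ⟨le_trans ?_ hζ.1, hζ.2⟩
    have : 0 ≤ Real.log (|ζ.im| + 1) := Real.log_nonneg (by linarith [abs_nonneg ζ.im])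
    nlinarith
  intro s t hst
  refine limsup_le_limsup (hmono s t hst) ?_ ?_
  · refine IsBoundedUnder.isCoboundedUnder_le ⟨0, ?_⟩
    rw [eventually_map]
    filter_upwards [eventually_gt_atTop 0] with R hR
    positivity
  -- Comparing upper limits requires boundedness at t itself, which may be a slope. It comes from
  -- some u > t that is not one, where the quotient converges.
  · obtain ⟨u, hu, hu'⟩ := (Set.Ioi_infinite t).exists_notMem_finite
      (Set.finite_range (mu a y v))
    obtain ⟨j, -, -, hlim, -⟩ := hv.exists_tendsto hN hy hu'
    exact hlim.isBoundedUnder_le.mono_le (hmono t u (le_of_lt hu))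

/-- If the maximizing vertices for s and t differed, a segment between them would have its slope in
[s, t], or both above t and below s. -/
theorem IsDistributionDiagram.logDensity_eq (hv : IsDistributionDiagram a y M v) (hN : 2 ≤ N)
    (hy : Function.Injective y) {s t : ℝ} (hst : s ≤ t) (h : ∀ n, mu a y v n ∉ Set.Icc s t) :
    logDensity a y s = logDensity a y t := by
  obtain ⟨i, hi1, hi2, -, hi⟩ := hv.exists_tendsto hN hy (μ := s)
    (by rintro ⟨n, rfl⟩; exact h n ⟨le_rfl, hst⟩)
  obtain ⟨j, hj1, hj2, -, hj⟩ := hv.exists_tendsto hN hy (μ := t)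
    (by rintro ⟨n, rfl⟩; exact h n ⟨hst, le_rfl⟩)
  rw [hi, hj]
  rcases lt_trichotomy i j with hij | hij | hij
  · obtain ⟨k, rfl⟩ := Fin.exists_castSucc_eq.mpr (hij.trans_le (Fin.le_last j)).ne
    linarith [hj1 k hij, hi2 k le_rfl]
  · rw [hij]
  · obtain ⟨k, rfl⟩ := Fin.exists_castSucc_eq.mpr (hij.trans_le (Fin.le_last i)).ne
    exact absurd ⟨(hi1 k hij).le, (hj2 k le_rfl).le⟩ (h k)

/-- Just below μ_n no other slope intervenes, so the segments with slope greater than s are exactly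
those up to the n-th, and the maximizing vertex is the right end of that segment. Just above μ_n it
is the left end. -/
theorem IsDistributionDiagram.tendsto_left (hv : IsDistributionDiagram a y M v) (hN : 2 ≤ N)
    (hy : Function.Injective y) (n : Fin M) :
    Tendsto (logDensity a y) (𝓝[<] (mu a y v n)) (𝓝 (-v n.succ / Real.pi)) := by
  have h1 : ∀ᶠ s in 𝓝[<] (mu a y v n), ∀ m, mu a y v m < mu a y v n → mu a y v m < s := by
    refine eventually_all.mpr fun m => ?_
    by_cases h : mu a y v m < mu a y v n
    · filter_upwards [nhdsWithin_le_nhds (eventually_gt_nhds h)] with s hs _ using hs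
    · exact Eventually.of_forall fun s h' => absurd h' h
  refine tendsto_const_nhds.congr' ?_
  filter_upwards [h1, self_mem_nhdsWithin] with s hs hsn
  have hsn : s < mu a y v n := hsn
  obtain ⟨j, hj1, hj2, -, hj⟩ := hv.exists_tendsto hN hy (μ := s) (by
    rintro ⟨m, rfl⟩
    exact lt_irrefl _ (hs m hsn))
  have h2 : n.castSucc < j := by
    by_contra! hcon
    exact lt_asymm hsn (hj2 n hcon)
  have h3 : j ≤ n.succ := by
    by_contra! hcon
    obtain ⟨k, hk⟩ := Fin.exists_castSucc_eq.mpr (hcon.trans_le (Fin.le_last j)).ne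
    have h4 : n < k := by
      rw [← Fin.castSucc_lt_castSucc_iff, hk]
      exact n.castSucc_lt_succ
    exact lt_asymm (hj1 k (hk ▸ hcon)) (hs k (hv.concave h4))
  rw [hj, le_antisymm h3 (Fin.castSucc_lt_iff_succ_le.mp h2)]

theorem IsDistributionDiagram.tendsto_right (hv : IsDistributionDiagram a y M v) (hN : 2 ≤ N)
    (hy : Function.Injective y) (n : Fin M) :
    Tendsto (logDensity a y) (𝓝[>] (mu a y v n)) (𝓝 (-v n.castSucc / Real.pi)) := by
  have h1 : ∀ᶠ s in 𝓝[>] (mu a y v n), ∀ m, mu a y v n < mu a y v m → s < mu a y v m := by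
    refine eventually_all.mpr fun m => ?_
    by_cases h : mu a y v n < mu a y v m
    · filter_upwards [nhdsWithin_le_nhds (eventually_lt_nhds h)] with s hs _ using hs
    · exact Eventually.of_forall fun s h' => absurd h' h
  refine tendsto_const_nhds.congr' ?_
  filter_upwards [h1, self_mem_nhdsWithin] with s hs hsn
  have hsn : mu a y v n < s := hsn
  obtain ⟨j, hj1, hj2, -, hj⟩ := hv.exists_tendsto hN hy (μ := s) (by
    rintro ⟨m, rfl⟩
    exact lt_irrefl _ (hs m hsn))
  have h2 : j ≤ n.castSucc := by
    by_contra! hcon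
    exact lt_asymm hsn (hj1 n hcon)
  have h3 : n.castSucc ≤ j := by
    by_contra! hcon
    obtain ⟨k, rfl⟩ := Fin.exists_castSucc_eq.mpr (hcon.trans n.castSucc_lt_last).ne
    exact lt_asymm (hs k (hv.concave (Fin.castSucc_lt_castSucc_iff.mp hcon))) (hj2 k le_rfl)
  rw [hj, le_antisymm h2 h3]

theorem IsDistributionDiagram.continuousAt_logDensity (hv : IsDistributionDiagram a y M v)
    (hN : 2 ≤ N) (hy : Function.Injective y) {μ : ℝ} (hμ : μ ∉ Set.range (mu a y v)) :
    ContinuousAt (logDensity a y) μ := by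
  have hopen : (Set.range (mu a y v))ᶜ ∈ 𝓝 μ :=
    (Set.finite_range (mu a y v)).isClosed.isOpen_compl.mem_nhds hμ
  obtain ⟨ε, hε, hball⟩ := Metric.mem_nhds_iff.mp hopen
  refine (tendsto_const_nhds (x := logDensity a y μ)).congr' ?_
  filter_upwards [Metric.ball_mem_nhds μ hε] with s hs
  rw [Metric.mem_ball, Real.dist_eq, abs_lt] at hs
  have hnot : ∀ n, ∀ x y', |x - μ| < ε → |y' - μ| < ε → mu a y v n ∉ Set.Icc x y' := by
    intro n x y' hx hy' hn
    rw [abs_lt] at hx hy'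
    refine hball ?_ ⟨n, rfl⟩
    rw [Metric.mem_ball, Real.dist_eq, abs_lt]
    constructor <;> linarith [hn.1, hn.2]
  have hμ0 : |μ - μ| < ε := by simpa using hε
  rcases le_total s μ with h | h
  · exact (hv.logDensity_eq hN hy h fun n => hnot n s μ (abs_lt.mpr hs) hμ0).symm
  · exact hv.logDensity_eq hN hy h fun n => hnot n μ s hμ0 (abs_lt.mpr hs)

theorem IsDistributionDiagram.not_continuousAt_logDensity (hv : IsDistributionDiagram a y M v)
    (hN : 2 ≤ N) (hy : Function.Injective y) (n : Fin M) :
    ¬ ContinuousAt (logDensity a y) (mu a y v n) := by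
  intro h
  have h1 := tendsto_nhds_unique (h.tendsto.mono_left nhdsWithin_le_nhds) (hv.tendsto_left hN hy n)
  have h2 := tendsto_nhds_unique (h.tendsto.mono_left nhdsWithin_le_nhds) (hv.tendsto_right hN hy n)
  have h3 := hv.width_pos n
  rw [h1, div_left_inj' Real.pi_ne_zero] at h2
  linarith

end PointInteraction

theorem corollaryc {N : ℕ} (hN : 2 ≤ N) (a : Fin N → ℂ) (y : Fin N → EuclideanSpace ℝ (Fin 3))
    (hy : Function.Injective y) :
    -- the distribution diagram exists
    (∃ (M : ℕ) (v : Fin (M + 1) → ℝ), PointInteraction.IsDistributionDiagram a y M v) ∧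
    ∀ (M : ℕ) (v : Fin (M + 1) → ℝ), PointInteraction.IsDistributionDiagram a y M v →
      1 ≤ M ∧
      -- the points `μ_n` are positive
      (∀ n : Fin M, 0 < PointInteraction.mu a y v n) ∧
      -- away from the points `μ_n` the limit that defines the density exists
      (∀ μ : ℝ, μ ∉ Set.range (PointInteraction.mu a y v) →
        Tendsto (fun R : ℝ => (PointInteraction.logCount a y μ R : ℝ) / R) atTop
          (𝓝 (PointInteraction.logDensity a y μ))) ∧
      -- the density is nondecreasing
      Monotone (PointInteraction.logDensity a y) ∧
      -- it is constant on each interval that contains none of the points `μ_n`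
      (∀ s t : ℝ, s ≤ t → (∀ n : Fin M, PointInteraction.mu a y v n ∉ Set.Icc s t) →
        PointInteraction.logDensity a y s = PointInteraction.logDensity a y t) ∧
      -- its jumps are exactly at the points `μ_n`
      {μ : ℝ | ¬ ContinuousAt (PointInteraction.logDensity a y) μ} =
        Set.range (PointInteraction.mu a y v) ∧
      -- the height of the jump at `μ_n`
      (∀ n : Fin M, ∃ dl dr : ℝ,
        Tendsto (PointInteraction.logDensity a y) (𝓝[<] (PointInteraction.mu a y v n)) (𝓝 dl) ∧
        Tendsto (PointInteraction.logDensity a y) (𝓝[>] (PointInteraction.mu a y v n)) (𝓝 dr) ∧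
        dr - dl = (v n.succ - v n.castSucc) / Real.pi ∧
        dr - dl = (PointInteraction.mult a y v n : ℝ) /
          (Real.pi * PointInteraction.mu a y v n)) := by
  refine ⟨PointInteraction.exists_isDistributionDiagram a hy, fun M v hv => ⟨hv.one_le hN hy,
    hv.mu_pos hN hy, fun μ hμ => ?_, hv.monotone_logDensity hN hy,
    fun s t hst h => hv.logDensity_eq hN hy hst h, ?_, fun n => ?_⟩⟩
  · obtain ⟨j, -, -, hlim, heq⟩ := hv.exists_tendsto hN hy hμ
    rwa [heq]
  · ext μ
    constructor
    · intro h
      by_contra hμ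
      exact h (hv.continuousAt_logDensity hN hy hμ)
    · rintro ⟨n, rfl⟩
      exact hv.not_continuousAt_logDensity hN hy n
  · have hjump : -v n.castSucc / Real.pi - -v n.succ / Real.pi =
        (v n.succ - v n.castSucc) / Real.pi := by ring
    refine ⟨_, _, hv.tendsto_left hN hy n, hv.tendsto_right hN hy n, hjump, ?_⟩
    have hmu := (hv.mu_pos hN hy n).ne'
    -- The multiplicity is slope times width, so dividing by πμ_n gives the same jump.
    have hmult : (PointInteraction.mult a y v n : ℝ) =
        PointInteraction.mu a y v n * (v n.succ - v n.castSucc) := by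
      rw [hv.mu_mul_width, PointInteraction.mult]
      push_cast
      ring
    rw [hjump, hmult, mul_comm Real.pi, mul_div_mul_left _ _ hmu]
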